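/- Let $n\ge 2$ and $p=\frac{2n}{n-1}$. Let $\mathbb D^n$ be the unit polydisc in $\mathbb C^n$, let $\Phi_n(w)=(p_1(w),\dots,p_n(w))$ with $p_j(w)=\sum_{k_1<\cdots<k_j}w_{k_1}\cdots w_{k_j}$, let $J_{\mathbb C}\Phi_n$ be the complex Jacobian determinant of $\Phi_n$ (so $J_{\mathbb C}\Phi_n(w)=\prod_{j<k}(w_j-w_k)$), and let $\mathbb G^n=\Phi_n(\mathbb D^n)$ be the symmetrized polydisc. For a domain $\Omega\subset\mathbb C^n$, the Bergman projection $P_\Omega$ is the orthogonal projection of $L^2(\Omega)$ onto the closed subspace of square-integrable holomorphic functions on $\Omega$. Let $L^p_{\mathrm{anti}}(\mathbb D^n,|J_{\mathbb C}\Phi_n|^{2-p})$ be the space of those $f$ with $\int_{\mathbb D^n}|f|^p|J_{\mathbb C}\Phi_n|^{2-p}\,dV<\infty$ that change sign (almost everywhere) whenever two of the variables $z_j,z_k$, $j\ne k$, are interchanged. As $p\ge 2$, this space is contained in $L^2(\mathbb D^n)$, and $L^p(\mathbb G^n)\subset L^2(\mathbb G^n)$. Then $P_{\mathbb D^n}$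 is unbounded on $L^p_{\mathrm{anti}}(\mathbb D^n,|J_{\mathbb C}\Phi_n|^{2-p})$: there is no constant $C$ such that $$\int_{\mathbb D^n}|P_{\mathbb D^n}f|^p\,|J_{\mathbb C}\Phi_n|^{2-p}\,dV\le C^p\int_{\mathbb D^n}|f|^p\,|J_{\mathbb C}\Phi_n|^{2-p}\,dV\qquad\text{for all } f\in L^p_{\mathrm{anti}}(\mathbb D^n,|J_{\mathbb C}\Phi_n|^{2-p}).$$ Moreover $P_{\mathbb G^n}$ is unbounded on $L^p(\mathbb G^n)$: there is no constant $C$ such that $\|P_{\mathbb G^n}h\|_{L^p(\mathbb G^n)}\le C\|h\|_{L^p(\mathbb G^n)}$ for all $h\in L^p(\mathbb G^n)$. -/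

import Mathlib

open MeasureTheory
open scoped NNReal ENNReal

noncomputable section

/-- The unit polydisc in `ℂⁿ`. -/
def polydisc (n : ℕ) : Set (Fin n → ℂ) := {z | ∀ i, ‖z i‖ < 1}

/-- The symmetrization map; its `i`-th coordinate (counted from `0`) is the elementary symmetric
polynomial of degree `i + 1`. -/
def symmMap (n : ℕ) (w : Fin n → ℂ) : Fin n → ℂ :=
  fun i => ∑ s ∈ Finset.powersetCard ((i : ℕ) + 1) (Finset.univ : Finset (Fin n)), ∏ j ∈ s, w j

/-- The symmetrized polydisc. -/
def symmPolydisc (n : ℕ) : Set (Fin n → ℂ) := symmMap n '' polydisc n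

/-- The complex Jacobian determinant of the symmetrization map. -/
def symmJacobian (n : ℕ) (w : Fin n → ℂ) : ℂ := (fderiv ℂ (symmMap n) w).det

/-- The Bergman space of `Ω`: the classes in `L²(Ω)` that have a representative holomorphic
on `Ω`. -/
def bergmanSpace {n : ℕ} (Ω : Set (Fin n → ℂ)) :
    Submodule ℂ (Lp ℂ 2 (volume.restrict Ω)) where
  carrier := {f | ∃ g : (Fin n → ℂ) → ℂ, DifferentiableOn ℂ g Ω ∧ f =ᵐ[volume.restrict Ω] g}
  zero_mem' := ⟨0, differentiableOn_const 0, Lp.coeFn_zero _ _ _⟩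
  add_mem' := by
    rintro a b ⟨g, hg, hag⟩ ⟨h, hh, hbh⟩
    exact ⟨g + h, hg.add hh, (Lp.coeFn_add a b).trans (hag.add hbh)⟩
  smul_mem' := by
    rintro c a ⟨g, hg, hag⟩
    exact ⟨c • g, hg.const_smul c, (Lp.coeFn_smul c a).trans (hag.const_smul c)⟩

/-- The Bergman projection of `Ω`: the orthogonal projection of `L²(Ω)` onto the Bergman space.
For open `Ω` the Bergman space is closed, so that taking its closure changes nothing there. -/
def bergmanProj {n : ℕ} (Ω : Set (Fin n → ℂ)) :
    Lp ℂ 2 (volume.restrict Ω) →L[ℂ] Lp ℂ 2 (volume.restrict Ω) :=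
  (bergmanSpace Ω).topologicalClosure.starProjection

/-- The Bergman projection of `Ω` is bounded, with respect to the norm of `Lᵖ(ν)`, on the class `X`
of functions on `Ω`. (The projection is evaluated at those members of `X` that lie in `L²(Ω)`.) -/
def BergmanBoundedOn {n : ℕ} (Ω : Set (Fin n → ℂ)) (p : ℝ≥0∞) (ν : Measure (Fin n → ℂ))
    (X : Set ((Fin n → ℂ) → ℂ)) : Prop :=
  ∃ C : ℝ≥0, ∀ f ∈ X, ∀ hf : MemLp f 2 (volume.restrict Ω),
    eLpNorm (bergmanProj Ω (hf.toLp f)) p ν ≤ C * eLpNorm f p ν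

/-- The measure `|J|^(2-p) dV` on the polydisc, `J` being the Jacobian of the symmetrization map. -/
def weightedMeasure (n : ℕ) (p : ℝ) : Measure (Fin n → ℂ) :=
  (volume.restrict (polydisc n)).withDensity
    fun w => ENNReal.ofReal (‖symmJacobian n w‖ ^ (2 - p))

/-- Anti-symmetry of a function on the polydisc, up to null sets. -/
def IsAntisymmFun {n : ℕ} (f : (Fin n → ℂ) → ℂ) : Prop :=
  ∀ j k : Fin n, j ≠ k →
    ∀ᵐ z ∂(volume.restrict (polydisc n)), f z = - f (fun i => z (Equiv.swap j k i))

/-- (Representatives of) the elements of the weighted space of anti-symmetric functions. -/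
def LpAnti (n : ℕ) (p : ℝ) : Set ((Fin n → ℂ) → ℂ) :=
  {f | MemLp f (ENNReal.ofReal p) (weightedMeasure n p) ∧ IsAntisymmFun f}

end

/-! Write `V` for the Vandermonde product, whose modulus is that of the Jacobian at points with
distinct coordinates, `D = ∏ (1 - a zᵢ)` with `0 < a < 1`, `W = |V|^(2-p)`, and `q` for the exponent
dual to `p`. The value of `p` is the one for which `(n-1)p = (n+1)q = 2n`. Put `f = V conj(D)
D^(-n)` (`testFun`) and `H = V D^(-(n+1))` (`antiKernel`). Then `|f|^p W`, `|H|^q W^(1-q)` and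
`conj(H) f` all equal `|V|² |D|^(-2n)` (`testDensity`) almost everywhere.

Let `E` (`mobPolydisc`) be the product of the pseudo-hyperbolic discs of radius 1/2 about `a`. The
Bergman projection of `F = 1_E H` is `c H` with `c > 0` independent of `a`
(`integral_mobPolydisc_antiKernel`). Indeed, an automorphism of the disc carries each factor of `E`
to a centred disc, `H` is an alternating sum of products of transplanted monomials, and integration
over a centred disc of radius 1/2 scales the pairing with `z^k` by `(1/2)^(2k+2)`; the product of
these factors is the same for every term of the sum.

If the projection were bounded with constant `C`, self-adjointness and Hölder would give, with `M`
and `M_E` the integrals of the density over the polydisc and over `E`, `c M = c|⟨H, f⟩| = |⟨F, Pf⟩|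
≤ C M^(1/p) M_E^(1/q)`, that is `M ≤ (C/c)^q M_E` for every `a` (`pairing_bound`,
`le_mul_of_mul_le_rpow`). This fails as `a → 1` (`exists_mul_lintegral_mobPolydisc_lt`). On `E` all
coordinates are within a multiple of `s = 1 - a` of 1. If instead one coordinate moves out to
distance `t` from 1, with `s ≪ t ≤ 1`, each dyadic range of `t` contributes an amount of the same
order as the bound for `M_E`, so `M / M_E` grows at least like `log(1/s)`.

For the symmetrized polydisc, `u ↦ V · (u ∘ Φ)` turns integrals there into `1/n!` times integrals
over the polydisc, and the same functions, divided by `V`, serve as test functions. -/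

/-! ### Vandermonde product, elementary symmetric polynomials and the Jacobian. -/

section Vandermonde

/-- The Vandermonde determinant `∏_{i<j} (z j - z i)`. -/
noncomputable def vand {n : ℕ} (z : Fin n → ℂ) : ℂ := (Matrix.vandermonde z).det

lemma vand_eq_prod {n : ℕ} (z : Fin n → ℂ) :
    vand z = ∏ i, ∏ j ∈ Finset.Ioi i, (z j - z i) := Matrix.det_vandermonde z

lemma vand_ne_zero_iff {n : ℕ} (z : Fin n → ℂ) : vand z ≠ 0 ↔ Function.Injective z :=
  Matrix.det_vandermonde_ne_zero_iff

lemma vand_comp_perm {n : ℕ} (z : Fin n → ℂ) (σ : Equiv.Perm (Fin n)) :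
    vand (fun i => z (σ i)) = (Equiv.Perm.sign σ : ℂ) * vand z := by
  unfold vand
  rw [← Matrix.det_permute σ (Matrix.vandermonde z)]
  rfl

lemma norm_vand_comp_perm {n : ℕ} (z : Fin n → ℂ) (σ : Equiv.Perm (Fin n)) :
    ‖vand (fun i => z (σ i))‖ = ‖vand z‖ := by
  rw [vand_comp_perm, norm_mul]
  rcases Int.units_eq_one_or (Equiv.Perm.sign σ) with h | h <;> simp [h]

lemma continuous_vand {n : ℕ} : Continuous (vand (n := n)) := by
  have : vand (n := n) = fun z => ∏ i, ∏ j ∈ Finset.Ioi i, (z j - z i) := funext vand_eq_prod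
  rw [this]; fun_prop

lemma differentiable_vand {n : ℕ} : Differentiable ℂ (vand (n := n)) := by
  have : vand (n := n) = fun z => ∏ i, ∏ j ∈ Finset.Ioi i, (z j - z i) := funext vand_eq_prod
  rw [this]; fun_prop

/-- Every unordered pair occurs twice on the left. This product is the determinant of the diagonal
matrix in `norm_symmJacobian`. -/
lemma norm_vand_sq {n : ℕ} (z : Fin n → ℂ) :
    ∏ k, ∏ l ∈ Finset.univ.erase k, ‖z l - z k‖ = ‖vand z‖ ^ 2 := by
  have h1 : ∀ k : Fin n, ∏ l ∈ Finset.univ.erase k, ‖z l - z k‖ =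
      (∏ l ∈ Finset.Ioi k, ‖z l - z k‖) * ∏ l ∈ Finset.Iio k, ‖z l - z k‖ := by
    intro k
    rw [← Finset.prod_union]
    · congr 1
      ext l
      simp only [Finset.mem_erase, Finset.mem_univ, Finset.mem_union, Finset.mem_Ioi,
        Finset.mem_Iio]
      grind
    · rw [Finset.disjoint_left]
      intro l hl hl'
      simp only [Finset.mem_Ioi, Finset.mem_Iio] at hl hl'
      exact absurd hl (not_lt.2 hl'.le)
  have h2 : ∏ k, ∏ l ∈ Finset.Iio k, ‖z l - z k‖ = ∏ k, ∏ l ∈ Finset.Ioi k, ‖z l - z k‖ := by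
    rw [Finset.prod_comm' (t' := Finset.univ) (s' := fun l => Finset.Ioi l) (by simp)]
    exact Finset.prod_congr rfl fun i _ => Finset.prod_congr rfl fun j _ => norm_sub_rev _ _
  simp_rw [h1]
  rw [Finset.prod_mul_distrib, h2, vand_eq_prod]
  simp_rw [norm_prod]
  ring

/-- Vieta's formula with two parameters: `t = 1`, `x = -z k` serves the Jacobian and the fibres of
`symmMap`, while `x = 1`, `t = -a` expresses `den` through `symmMap`. -/
lemma prod_add_mul_eq_symmMap {n : ℕ} (z : Fin n → ℂ) (x t : ℂ) :
    ∏ i, (x + t * z i) = x ^ n + ∑ i : Fin n, t ^ ((i : ℕ) + 1) * x ^ (n - 1 - (i : ℕ)) *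
      symmMap n z i := by
  simp_rw [add_comm x]
  rw [Finset.prod_add, Finset.sum_powerset]
  simp only [Finset.card_univ, Fintype.card_fin]
  rw [Finset.sum_range_succ', add_comm]
  congr 1
  · simp
  · rw [Finset.sum_range]
    refine Finset.sum_congr rfl fun i _ => ?_
    unfold symmMap
    rw [Finset.mul_sum]
    refine Finset.sum_congr rfl fun s hs => ?_
    rw [Finset.mem_powersetCard] at hs
    rw [Finset.prod_mul_distrib, Finset.prod_const, Finset.prod_const, hs.2,
      Finset.card_sdiff_of_subset hs.1, hs.2, Finset.card_univ, Fintype.card_fin]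
    have : n - (↑i + 1) = n - 1 - (i : ℕ) := by omega
    rw [this]; ring

lemma symmMap_comp_perm {n : ℕ} (z : Fin n → ℂ) (σ : Equiv.Perm (Fin n)) :
    symmMap n (fun i => z (σ i)) = symmMap n z := by
  funext i
  unfold symmMap
  refine Finset.sum_equiv (Equiv.finsetCongr σ) ?_ ?_
  · intro s
    simp [Finset.mem_powersetCard]
  · intro s _
    simp

/-- Both tuples are the roots of one polynomial. Multiplicities are not tracked; equality of the
sets of roots suffices below. -/
lemma range_eq_of_symmMap_eq {n : ℕ} {z z' : Fin n → ℂ} (h : symmMap n z = symmMap n z') :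
    Set.range z = Set.range z' := by
  have key : ∀ {z z' : Fin n → ℂ}, symmMap n z = symmMap n z' → Set.range z ⊆ Set.range z' := by
    rintro z z' h _ ⟨i, rfl⟩
    have h1 := prod_add_mul_eq_symmMap z (-z i) 1
    rw [h, ← prod_add_mul_eq_symmMap z' (-z i) 1,
      Finset.prod_eq_zero (Finset.mem_univ i) (by ring)] at h1
    obtain ⟨j, -, hj⟩ := Finset.prod_eq_zero_iff.1 h1.symm
    exact ⟨j, by linear_combination hj⟩
  exact (key h).antisymm (key h.symm)

lemma differentiable_symmMap (n : ℕ) : Differentiable ℂ (symmMap n) := by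
  rw [differentiable_pi]
  intro i
  unfold symmMap
  fun_prop

/-- By Vieta, the map `w ↦ (∏ᵢ (wᵢ - z k))ₖ` is, up to an additive constant, a Vandermonde matrix
applied to `symmMap`. Its derivative at `w = z` is diagonal, with determinant of modulus `‖vand
z‖²`; cancelling the Vandermonde determinant leaves the Jacobian. -/
lemma norm_symmJacobian {n : ℕ} {z : Fin n → ℂ} (hz : Function.Injective z) :
    ‖symmJacobian n z‖ = ‖vand z‖ := by
  have hv : vand z ≠ 0 := (vand_ne_zero_iff z).2 hz
  set D := fderiv ℂ (symmMap n) z with hD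
  have hDd : HasFDerivAt (symmMap n) D z := (differentiable_symmMap n z).hasFDerivAt
  let A : Matrix (Fin n) (Fin n) ℂ := Matrix.projVandermonde 1 (fun k => -z k)
  have hA : A.det = vand z := by
    rw [Matrix.det_projVandermonde, vand_eq_prod]
    refine Finset.prod_congr rfl fun i _ => Finset.prod_congr rfl fun j _ => ?_
    simp only [Pi.one_apply]; ring
  have hcomp : (Matrix.toLin' A) ∘ₗ (D : (Fin n → ℂ) →ₗ[ℂ] (Fin n → ℂ)) =
      Matrix.toLin' (Matrix.diagonal fun k => ∏ l ∈ Finset.univ.erase k, (-z k + 1 * z l)) := by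
    ext1 m
    ext k
    have e1 : HasFDerivAt (fun w : Fin n → ℂ => ∏ i, (-z k + 1 * w i))
        (∑ i, (∏ l ∈ Finset.univ.erase i, (-z k + 1 * z l)) •
          ((1 : ℂ) • (ContinuousLinearMap.proj i : (Fin n → ℂ) →L[ℂ] ℂ))) z := by
      refine HasFDerivAt.finsetProd fun i _ => ?_
      exact ((hasFDerivAt_apply i z).const_mul 1).const_add _
    have e2 : HasFDerivAt (fun w : Fin n → ℂ => (-z k) ^ n + ∑ i : Fin n,
        1 ^ ((i : ℕ) + 1) * (-z k) ^ (n - 1 - (i : ℕ)) * symmMap n w i)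
        (∑ i : Fin n, (1 ^ ((i : ℕ) + 1) * (-z k) ^ (n - 1 - (i : ℕ))) •
          ((ContinuousLinearMap.proj i).comp D)) z := by
      refine HasFDerivAt.const_add _ (HasFDerivAt.fun_sum fun i _ => HasFDerivAt.const_mul ?_ _)
      exact hasFDerivAt_pi'.1 hDd i
    rw [← funext fun w => prod_add_mul_eq_symmMap w (-z k) 1] at e2
    have e3 := e1.unique e2
    have e4 := congrArg (fun T => T (Pi.single m 1)) e3
    simp only [sum_apply, smul_apply,
      ContinuousLinearMap.comp_apply, ContinuousLinearMap.proj_apply, smul_eq_mul] at e4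
    simp only [LinearMap.comp_apply, LinearMap.single_apply, Matrix.toLin'_apply,
      Matrix.mulVec, dotProduct, Matrix.diagonal_apply, ContinuousLinearMap.coe_coe]
    convert e4.symm using 1
    · refine Finset.sum_congr rfl fun i _ => ?_
      simp only [A, Matrix.projVandermonde_apply, Fin.val_rev, Pi.one_apply]
      rw [one_pow, one_pow, Nat.sub_sub, Nat.add_comm 1]
    · rw [Finset.sum_eq_single k (by intro b _ hb; simp [Ne.symm hb]) (by simp)]
      rw [Finset.sum_eq_single m (by intro b _ hb; simp [hb]) (by simp)]
      by_cases hkm : k = m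
      · subst hkm; simp
      · rw [Pi.single_eq_of_ne hkm]
        -- For `m ≠ k` the product still contains the factor with index `k`, which vanishes at `w =
        -- z`.
        rw [Finset.prod_eq_zero (Finset.mem_erase.2 ⟨hkm, Finset.mem_univ k⟩) (by ring)]
        simp
  have hdet := congrArg LinearMap.det hcomp
  rw [LinearMap.det_comp, LinearMap.det_toLin', LinearMap.det_toLin', Matrix.det_diagonal,
    hA] at hdet
  have hn := congrArg norm hdet
  rw [norm_mul, norm_prod] at hn
  simp_rw [norm_prod] at hn
  have h3 : ∏ k, ∏ l ∈ Finset.univ.erase k, ‖-z k + 1 * z l‖ = ‖vand z‖ ^ 2 := by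
    rw [← norm_vand_sq]
    refine Finset.prod_congr rfl fun i _ => Finset.prod_congr rfl fun j _ => ?_
    congr 1; ring
  rw [h3, sq] at hn
  exact mul_left_cancel₀ (norm_ne_zero_iff.2 hv) hn

end Vandermonde

/-! ### Moments of holomorphic functions over centred discs. -/

section OneVariable

open ComplexConjugate Metric Set

/-- On the circle of radius `τ` one has `conj z ^ k = τ^(2k) z^(-k)`, so the normalized moment is a
contour integral of `h z / z^(k+1)`, which does not depend on the radius. -/
lemma circle_moment {h : ℂ → ℂ} (hh : DifferentiableOn ℂ h (ball 0 1)) (k : ℕ) {ρ σ : ℝ}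
    (hρ : 0 < ρ) (hρσ : ρ ≤ σ) (hσ : σ < 1) :
    ((σ : ℂ) ^ (2 * k))⁻¹ * ∫ θ in (-Real.pi)..Real.pi,
        conj (circleMap 0 σ θ) ^ k * h (circleMap 0 σ θ) =
    ((ρ : ℂ) ^ (2 * k))⁻¹ * ∫ θ in (-Real.pi)..Real.pi,
        conj (circleMap 0 ρ θ) ^ k * h (circleMap 0 ρ θ) := by
  have key : ∀ τ : ℝ, 0 < τ → (∮ z in C(0, τ), (z - 0)⁻¹ • ((z ^ k)⁻¹ * h z)) =
      Complex.I * (((τ : ℂ) ^ (2 * k))⁻¹ * ∫ θ in (-Real.pi)..Real.pi,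
        conj (circleMap 0 τ θ) ^ k * h (circleMap 0 τ θ)) := by
    intro τ hτ
    have hτ' : (τ : ℂ) ≠ 0 := by exact_mod_cast hτ.ne'
    rw [← mul_assoc, ← intervalIntegral.integral_const_mul]
    have hper : Function.Periodic (fun θ : ℝ => Complex.I * ((τ : ℂ) ^ (2 * k))⁻¹ *
        (conj (circleMap 0 τ θ) ^ k * h (circleMap 0 τ θ))) (2 * Real.pi) := by
      intro θ
      simp only [periodic_circleMap 0 τ θ]
    have := hper.intervalIntegral_add_eq 0 (-Real.pi)
    rw [zero_add, show -Real.pi + 2 * Real.pi = Real.pi by ring] at this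
    rw [← this]
    unfold circleIntegral
    refine intervalIntegral.integral_congr fun θ _ => ?_
    simp only [smul_eq_mul, sub_zero, deriv_circleMap]
    have hz : circleMap 0 τ θ ≠ 0 := circleMap_ne_center hτ.ne'
    have h1 : conj (circleMap 0 τ θ) * circleMap 0 τ θ = (τ : ℂ) ^ 2 := by
      rw [mul_comm, Complex.mul_conj, Complex.normSq_eq_norm_sq]
      simp [abs_of_pos hτ]
    have h2 : (conj (circleMap 0 τ θ)) ^ k = (τ : ℂ) ^ (2 * k) * ((circleMap 0 τ θ) ^ k)⁻¹ := by
      rw [pow_mul, ← h1, mul_pow]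
      field_simp
    rw [h2]
    field_simp
  have hann := Complex.circleIntegral_sub_center_inv_smul_eq_of_differentiable_on_annulus_off_countable
    (c := 0) (f := fun z => (z ^ k)⁻¹ * h z) hρ hρσ (s := ∅) countable_empty ?_ ?_
  · rw [key σ (hρ.trans_le hρσ), key ρ hρ] at hann
    exact mul_left_cancel₀ Complex.I_ne_zero hann
  · intro z hz
    have hz0 : z ≠ 0 := by
      rintro rfl
      exact hz.2 (mem_ball_self hρ)
    have hzb : z ∈ ball (0 : ℂ) 1 := closedBall_subset_ball hσ hz.1
    refine ContinuousAt.continuousWithinAt ?_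
    exact ((continuousAt_id.pow k).inv₀ (pow_ne_zero k hz0)).mul
      (hh.differentiableAt (isOpen_ball.mem_nhds hzb)).continuousAt
  · intro z hz
    have hz0 : z ≠ 0 := by
      rintro rfl
      exact hz.1.2 (mem_closedBall_self hρ.le)
    have hzb : z ∈ ball (0 : ℂ) 1 := ball_subset_ball hσ.le hz.1.1
    exact ((differentiableAt_id.pow k).inv (pow_ne_zero k hz0)).mul
      (hh.differentiableAt (isOpen_ball.mem_nhds hzb))

lemma exists_integral_closedBall_eq {h : ℂ → ℂ} (hh : DifferentiableOn ℂ h (ball 0 1)) (k : ℕ) :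
    ∃ B : ℂ, ∀ r : ℝ, 0 < r → r < 1 →
      ∫ z in closedBall (0 : ℂ) r, conj z ^ k * h z = (r : ℂ) ^ (2 * k + 2) * B := by
  set A : ℂ := (((1 / 2 : ℝ) : ℂ) ^ (2 * k))⁻¹ * ∫ θ in (-Real.pi)..Real.pi,
        conj (circleMap 0 (1 / 2 : ℝ) θ) ^ k * h (circleMap 0 (1 / 2 : ℝ) θ) with hA
  have hcirc : ∀ ρ : ℝ, 0 < ρ → ρ < 1 → ∫ θ in (-Real.pi)..Real.pi,
        conj (circleMap 0 ρ θ) ^ k * h (circleMap 0 ρ θ) = (ρ : ℂ) ^ (2 * k) * A := by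
    intro ρ h0 h1
    have hρ' : (ρ : ℂ) ≠ 0 := by exact_mod_cast h0.ne'
    have : ((ρ : ℂ) ^ (2 * k))⁻¹ * ∫ θ in (-Real.pi)..Real.pi,
        conj (circleMap 0 ρ θ) ^ k * h (circleMap 0 ρ θ) = A := by
      rcases le_total ρ (1 / 2) with h | h
      · exact (circle_moment hh k h0 h (by norm_num)).symm
      · exact circle_moment hh k (by norm_num) h h1
    rw [← this]
    field_simp
  -- The circle moment `ρ^(2k) A` times the polar Jacobian `ρ`, integrated over `0 < ρ < r`.
  refine ⟨A / (2 * k + 2), fun r hr hr1 => ?_⟩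
  rw [← integral_indicator isClosed_closedBall.measurableSet, ← Complex.integral_comp_polarCoord_symm]
  have hsymm : ∀ p : ℝ × ℝ, Complex.polarCoord.symm p = circleMap 0 p.1 p.2 := by
    intro p
    rw [Complex.polarCoord_symm_apply, circleMap, Complex.exp_mul_I]
    push_cast; ring
  have hset : ∀ p ∈ polarCoord.target, p.1 • (closedBall (0 : ℂ) r).indicator
      (fun z => conj z ^ k * h z) (Complex.polarCoord.symm p) =
      (Ioc 0 r ×ˢ Ioo (-Real.pi) Real.pi).indicator
        (fun p : ℝ × ℝ => p.1 • (conj (circleMap 0 p.1 p.2) ^ k * h (circleMap 0 p.1 p.2))) p := by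
    intro p hp
    rw [polarCoord_target] at hp
    have hp1 : 0 < p.1 := hp.1
    rw [hsymm]
    by_cases hpr : p.1 ≤ r
    · rw [indicator_of_mem, indicator_of_mem]
      · exact ⟨⟨hp1, hpr⟩, hp.2⟩
      · simpa [abs_of_pos hp1] using hpr
    · rw [indicator_of_notMem, indicator_of_notMem, smul_zero]
      · exact fun h => hpr h.1.2
      · simpa [abs_of_pos hp1] using hpr
  rw [setIntegral_congr_fun polarCoord.open_target.measurableSet hset,
    setIntegral_indicator (measurableSet_Ioc.prod measurableSet_Ioo)]
  have hinter : polarCoord.target ∩ Ioc 0 r ×ˢ Ioo (-Real.pi) Real.pi =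
      Ioc 0 r ×ˢ Ioo (-Real.pi) Real.pi := by
    rw [polarCoord_target, inter_eq_right]
    exact prod_mono (fun x hx => hx.1) subset_rfl
  rw [hinter, Measure.volume_eq_prod, setIntegral_prod]
  · have h1 : ∀ ρ ∈ Ioc 0 r, (∫ θ in Ioo (-Real.pi) Real.pi,
        ρ • (conj (circleMap 0 ρ θ) ^ k * h (circleMap 0 ρ θ))) = (ρ : ℂ) ^ (2 * k + 1) * A := by
      intro ρ hρ
      rw [integral_smul, ← integral_Ioc_eq_integral_Ioo,
        ← intervalIntegral.integral_of_le (by linarith [Real.pi_pos]),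
        hcirc ρ hρ.1 (hρ.2.trans_lt hr1), Complex.real_smul]
      ring
    rw [setIntegral_congr_fun measurableSet_Ioc h1, ← intervalIntegral.integral_of_le hr.le,
      intervalIntegral.integral_mul_const]
    have : ∫ x in (0 : ℝ)..r, (x : ℂ) ^ (2 * k + 1) = (r : ℂ) ^ (2 * k + 2) / (2 * k + 2) := by
      have h2 : ∀ x : ℝ, (x : ℂ) ^ (2 * k + 1) = ((x ^ (2 * k + 1) : ℝ) : ℂ) := by
        intro x; push_cast; rfl
      simp_rw [h2]
      rw [intervalIntegral.integral_ofReal, integral_pow]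
      push_cast
      ring_nf
    rw [this]
    ring
  · have hc : ContinuousOn (fun p : ℝ × ℝ =>
        p.1 • (conj (circleMap 0 p.1 p.2) ^ k * h (circleMap 0 p.1 p.2)))
        (Icc 0 r ×ˢ Icc (-Real.pi) Real.pi) := by
      have hcm : Continuous fun p : ℝ × ℝ => circleMap 0 p.1 p.2 := by
        unfold circleMap; fun_prop
      refine continuous_fst.continuousOn.smul (ContinuousOn.mul ?_ ?_)
      · exact ((Complex.continuous_conj.comp hcm).pow k).continuousOn
      · refine hh.continuousOn.comp hcm.continuousOn fun p hp => ?_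
        simp only [mem_ball_zero_iff, norm_circleMap_zero, abs_of_nonneg hp.1.1]
        exact hp.1.2.trans_lt hr1
    exact (hc.integrableOn_compact (isCompact_Icc.prod isCompact_Icc)).mono_set
      (prod_mono Ioc_subset_Icc_self Ioo_subset_Icc_self)

/-- Letting the radius tend to 1 identifies the constant `B` of `exists_integral_closedBall_eq` with
the integral over the unit disc. -/
lemma integral_closedBall_eq_mul_integral_ball {h : ℂ → ℂ} (hh : DifferentiableOn ℂ h (ball 0 1))
    (k : ℕ) (hint : IntegrableOn (fun z => conj z ^ k * h z) (ball 0 1)) {r : ℝ} (hr : 0 < r)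
    (hr1 : r < 1) :
    ∫ z in closedBall (0 : ℂ) r, conj z ^ k * h z =
      (r : ℂ) ^ (2 * k + 2) * ∫ z in ball (0 : ℂ) 1, conj z ^ k * h z := by
  obtain ⟨B, hB⟩ := exists_integral_closedBall_eq hh k
  have hU : (⋃ m : ℕ, closedBall (0 : ℂ) (1 - 1 / ((m : ℝ) + 2))) = ball 0 1 := by
    ext z
    simp only [mem_iUnion, mem_closedBall_zero_iff, mem_ball_zero_iff]
    constructor
    · rintro ⟨m, hm⟩
      have : 0 < 1 / ((m : ℝ) + 2) := by positivity
      linarith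
    · intro hz
      obtain ⟨m, hm⟩ := exists_nat_gt (1 / (1 - ‖z‖))
      refine ⟨m, ?_⟩
      have h1 : 0 < 1 - ‖z‖ := by linarith
      have : 1 / ((m : ℝ) + 2) ≤ 1 - ‖z‖ := by
        rw [div_le_iff₀ (by positivity)]
        rw [div_lt_iff₀ h1] at hm
        nlinarith
      linarith
  have hlim := tendsto_setIntegral_of_monotone (μ := volume)
    (f := fun z : ℂ => conj z ^ k * h z) (s := fun m : ℕ => closedBall (0 : ℂ) (1 - 1 / ((m : ℝ) + 2)))
    (fun m => isClosed_closedBall.measurableSet) (fun m m' hmm => by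
      apply closedBall_subset_closedBall
      have : (m : ℝ) ≤ m' := by exact_mod_cast hmm
      gcongr) (by rw [hU]; exact hint)
  rw [hU] at hlim
  have hlim2 : Filter.Tendsto (fun m : ℕ => (((1 - 1 / ((m : ℝ) + 2) : ℝ) : ℂ)) ^ (2 * k + 2) * B)
      Filter.atTop (nhds ((((1 - 0 : ℝ) : ℂ)) ^ (2 * k + 2) * B)) := by
    refine Filter.Tendsto.mul_const _ (Filter.Tendsto.pow ?_ _)
    refine (Complex.continuous_ofReal.tendsto _).comp (tendsto_const_nhds.sub ?_)
    have := tendsto_one_div_add_atTop_nhds_zero_nat (𝕜 := ℝ)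
    have h3 := (Filter.tendsto_add_atTop_iff_nat 1).2 this
    refine h3.congr fun m => ?_
    push_cast; ring
  have heq := tendsto_nhds_unique (hlim.congr fun m => hB _ ?_ ?_) hlim2
  · rw [heq, hB r hr hr1]
    norm_num
  · have : 1 / ((m : ℝ) + 2) ≤ 1 / 2 := by gcongr; linarith [(Nat.cast_nonneg m : (0 : ℝ) ≤ m)]
    linarith
  · have : 0 < 1 / ((m : ℝ) + 2) := by positivity
    linarith

end OneVariable

/-! ### The real determinant of a complex linear map. -/

section RealDeterminant

lemma abs_det_restrictScalars {E : Type*} [NormedAddCommGroup E] [NormedSpace ℂ E] (D : E →L[ℂ] E) :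
    |(D.restrictScalars ℝ).det| = ‖D.det‖ ^ 2 := by
  have h : (D.restrictScalars ℝ).det = Algebra.norm ℝ D.det :=
    LinearMap.det_restrictScalars (R := ℝ) (f := (D : E →ₗ[ℂ] E))
  rw [h, Algebra.norm_complex_apply, Complex.normSq_eq_norm_sq, abs_of_nonneg (by positivity)]

end RealDeterminant

/-! ### Transplantation of the moments by a disc automorphism. -/

section Moebius

open ComplexConjugate Metric Set

/-- The involutive automorphism of the unit disc interchanging `0` and `a`. -/
noncomputable def mob (a : ℝ) (z : ℂ) : ℂ := (a - z) / (1 - a * z)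

/-- The pseudo-hyperbolic disc of radius `1/2` around `a`. -/
def mobDisc (a : ℝ) : Set ℂ := {z | ‖(a : ℂ) - z‖ ≤ 1 / 2 * ‖1 - (a : ℂ) * z‖}

/-- The image of `z ^ k` under the unitary action of `mob a` on the Bergman space of the disc. -/
noncomputable def mobMonomial (a : ℝ) (k : ℕ) (z : ℂ) : ℂ := mob a z ^ k * ((1 - a * z) ^ 2)⁻¹

variable {a : ℝ}

lemma one_sub_mul_ne_zero (ha0 : 0 < a) (ha1 : a < 1) {z : ℂ} (hz : ‖z‖ < 1) : 1 - (a : ℂ) * z ≠ 0 := by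
  intro h
  have h1 : (a : ℂ) * z = 1 := by linear_combination -h
  have h2 := congrArg norm h1
  rw [norm_mul, Complex.norm_real, Real.norm_eq_abs, abs_of_pos ha0, norm_one] at h2
  nlinarith [norm_nonneg z]

lemma norm_sq_sub_norm_sq (a : ℝ) (z : ℂ) :
    ‖1 - (a : ℂ) * z‖ ^ 2 - ‖(a : ℂ) - z‖ ^ 2 = (1 - a ^ 2) * (1 - ‖z‖ ^ 2) := by
  simp only [← Complex.normSq_eq_norm_sq, Complex.normSq_apply, Complex.sub_re, Complex.sub_im,
    Complex.mul_re, Complex.mul_im, Complex.ofReal_re, Complex.ofReal_im, Complex.one_re,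
    Complex.one_im]
  ring

/-- By `norm_sq_sub_norm_sq`, `‖z‖ ≥ 1` would give `‖1 - a z‖ ≤ ‖a - z‖`, against the factor 1/2 in
the definition of `mobDisc`. -/
lemma norm_lt_one_of_mem_mobDisc (ha0 : 0 < a) (ha1 : a < 1) {z : ℂ} (hz : z ∈ mobDisc a) : ‖z‖ < 1 := by
  have h : ‖(a : ℂ) - z‖ ≤ 1 / 2 * ‖1 - (a : ℂ) * z‖ := hz
  have h1 := norm_sq_sub_norm_sq a z
  have h2 : 0 < ‖1 - (a : ℂ) * z‖ := by
    rw [norm_pos_iff]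
    intro h0
    rw [h0] at h
    have h3 : (a : ℂ) - z = 0 := by simpa using h
    have h4 : z = a := by linear_combination -h3
    rw [h4] at h0
    have : (1 : ℝ) - a * a = 0 := by exact_mod_cast h0
    nlinarith
  by_contra hlt
  push Not at hlt
  have h3 : (1 - a ^ 2) * (1 - ‖z‖ ^ 2) ≤ 0 := by
    apply mul_nonpos_of_nonneg_of_nonpos <;> nlinarith
  nlinarith [norm_nonneg ((a : ℂ) - z)]

lemma isClosed_mobDisc (a : ℝ) : IsClosed (mobDisc a) :=
  isClosed_le (by fun_prop) (by fun_prop)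

lemma isCompact_mobDisc (ha0 : 0 < a) (ha1 : a < 1) : IsCompact (mobDisc a) :=
  (isCompact_closedBall (0 : ℂ) 1).of_isClosed_subset (isClosed_mobDisc a) fun z hz => by
    simpa using (norm_lt_one_of_mem_mobDisc ha0 ha1 hz).le

lemma one_sub_mul_mob (ha0 : 0 < a) (ha1 : a < 1) {z : ℂ} (hz : ‖z‖ < 1) :
    1 - (a : ℂ) * mob a z = (1 - a ^ 2) / (1 - a * z) := by
  have := one_sub_mul_ne_zero ha0 ha1 hz
  unfold mob
  field_simp
  ring

lemma one_sub_sq_ne_zero (ha0 : 0 < a) (ha1 : a < 1) : (1 : ℂ) - (a : ℂ) ^ 2 ≠ 0 := by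
  have : (1 : ℝ) - a ^ 2 ≠ 0 := by nlinarith
  exact_mod_cast this

lemma mob_mob (ha0 : 0 < a) (ha1 : a < 1) {z : ℂ} (hz : ‖z‖ < 1) : mob a (mob a z) = z := by
  have h0 := one_sub_mul_ne_zero ha0 ha1 hz
  have h1 := one_sub_sq_ne_zero ha0 ha1
  rw [mob, one_sub_mul_mob ha0 ha1 hz, mob]
  field_simp
  ring

lemma norm_mob_lt_one (ha0 : 0 < a) (ha1 : a < 1) {z : ℂ} (hz : ‖z‖ < 1) : ‖mob a z‖ < 1 := by
  have h0 := one_sub_mul_ne_zero ha0 ha1 hz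
  rw [mob, norm_div, div_lt_one (norm_pos_iff.2 h0)]
  have h1 := norm_sq_sub_norm_sq a z
  have h3 : 0 < (1 - a ^ 2) * (1 - ‖z‖ ^ 2) := by
    apply mul_pos <;> nlinarith [norm_nonneg z]
  exact lt_of_pow_lt_pow_left₀ 2 (norm_nonneg _) (by linarith)

lemma mob_image_ball (ha0 : 0 < a) (ha1 : a < 1) : mob a '' ball 0 1 = ball 0 1 := by
  ext z
  simp only [mem_image, mem_ball_zero_iff]
  constructor
  · rintro ⟨w, hw, rfl⟩
    exact norm_mob_lt_one ha0 ha1 hw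
  · intro hz
    exact ⟨mob a z, norm_mob_lt_one ha0 ha1 hz, mob_mob ha0 ha1 hz⟩

lemma mob_mem_closedBall_iff (ha0 : 0 < a) (ha1 : a < 1) {z : ℂ} (hz : ‖z‖ < 1) :
    mob a z ∈ closedBall (0 : ℂ) (1 / 2) ↔ z ∈ mobDisc a := by
  rw [mem_closedBall_zero_iff, mob, norm_div,
    div_le_iff₀ (norm_pos_iff.2 (one_sub_mul_ne_zero ha0 ha1 hz))]
  rfl

lemma mob_image_closedBall (ha0 : 0 < a) (ha1 : a < 1) :
    mob a '' closedBall 0 (1 / 2) = mobDisc a := by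
  ext z
  constructor
  · rintro ⟨w, hw, rfl⟩
    have hw1 : ‖w‖ < 1 := by
      rw [mem_closedBall_zero_iff] at hw; linarith
    rw [← mob_mem_closedBall_iff ha0 ha1 (norm_mob_lt_one ha0 ha1 hw1), mob_mob ha0 ha1 hw1]
    exact hw
  · intro hz
    have hz1 := norm_lt_one_of_mem_mobDisc ha0 ha1 hz
    exact ⟨mob a z, (mob_mem_closedBall_iff ha0 ha1 hz1).2 hz, mob_mob ha0 ha1 hz1⟩

lemma mob_injOn (ha0 : 0 < a) (ha1 : a < 1) : InjOn (mob a) (ball 0 1) := fun x hx y hy h => by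
  rw [mem_ball_zero_iff] at hx hy
  rw [← mob_mob ha0 ha1 hx, h, mob_mob ha0 ha1 hy]

lemma hasDerivAt_mob (ha0 : 0 < a) (ha1 : a < 1) {z : ℂ} (hz : ‖z‖ < 1) :
    HasDerivAt (mob a) (-(1 - a ^ 2) / (1 - a * z) ^ 2) z := by
  have h0 := one_sub_mul_ne_zero ha0 ha1 hz
  have h1 : HasDerivAt (fun z : ℂ => (a : ℂ) - z) (-1) z := (hasDerivAt_id z).const_sub _
  have h2 : HasDerivAt (fun z : ℂ => 1 - (a : ℂ) * z) (-(a * 1)) z :=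
    ((hasDerivAt_id z).const_mul _).const_sub _
  refine (h1.div h2 h0).congr_deriv ?_
  congr 1
  ring

lemma det_smulRight_one (c : ℂ) : ((1 : ℂ →L[ℂ] ℂ).smulRight c).det = c := by
  have : ((1 : ℂ →L[ℂ] ℂ).smulRight c).det = ((1 : ℂ →L[ℂ] ℂ).smulRight c) 1 :=
    LinearMap.det_ring _
  rw [this]; simp

lemma hasFDerivWithinAt_mob (ha0 : 0 < a) (ha1 : a < 1) {s : Set ℂ} (hs : s ⊆ ball 0 1) :
    ∀ z ∈ s, HasFDerivWithinAt (mob a) (((1 : ℂ →L[ℂ] ℂ).smulRight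
      (-(1 - (a : ℂ) ^ 2) / (1 - a * z) ^ 2)).restrictScalars ℝ) s z := fun _ hz =>
  ((hasDerivAt_mob ha0 ha1 (mem_ball_zero_iff.1 (hs hz))).hasFDerivAt.restrictScalars
    ℝ).hasFDerivWithinAt

/-- The real Jacobian is `φ' conj(φ')` for `φ = mob a`. Its conjugate half cancels the conjugated
factor of `mobMonomial`, and the other half cancels numerically, so that what multiplies `conj w ^
k` is again holomorphic. -/
lemma mobMonomial_transform (ha0 : 0 < a) (ha1 : a < 1) (k : ℕ) (h : ℂ → ℂ) {w : ℂ} (hw : ‖w‖ < 1) :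
    ‖-(1 - (a : ℂ) ^ 2) / (1 - a * w) ^ 2‖ ^ 2 • (conj (mobMonomial a k (mob a w)) * h (mob a w)) =
      conj w ^ k * (h (mob a w) * ((1 - a * w) ^ 2)⁻¹) := by
  have h0 := one_sub_mul_ne_zero ha0 ha1 hw
  have h0' : conj (1 - (a : ℂ) * w) ≠ 0 := (map_ne_zero _).2 h0
  have h1 := one_sub_sq_ne_zero ha0 ha1
  have h1' : conj ((1 : ℂ) - (a : ℂ) ^ 2) = 1 - (a : ℂ) ^ 2 := by simp
  have h2 : ((‖-(1 - (a : ℂ) ^ 2) / (1 - a * w) ^ 2‖ ^ 2 : ℝ) : ℂ) =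
      (-(1 - (a : ℂ) ^ 2) / (1 - a * w) ^ 2) * (-(1 - (a : ℂ) ^ 2) / conj (1 - a * w) ^ 2) := by
    rw [← Complex.normSq_eq_norm_sq, ← Complex.mul_conj, map_div₀, map_neg, h1', map_pow]
  rw [Complex.real_smul, h2, mobMonomial, mob_mob ha0 ha1 hw, one_sub_mul_mob ha0 ha1 hw]
  rw [map_mul, map_pow, map_inv₀, map_pow, map_div₀, h1']
  field_simp

lemma integral_mobMonomial_image (ha0 : 0 < a) (ha1 : a < 1) (k : ℕ) (h : ℂ → ℂ) {s : Set ℂ}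
    (hsm : MeasurableSet s) (hs : s ⊆ ball 0 1) :
    ∫ z in mob a '' s, conj (mobMonomial a k z) * h z =
      ∫ w in s, conj w ^ k * (h (mob a w) * ((1 - a * w) ^ 2)⁻¹) := by
  rw [integral_image_eq_integral_abs_det_fderiv_smul volume hsm (hasFDerivWithinAt_mob ha0 ha1 hs)
    ((mob_injOn ha0 ha1).mono hs)]
  refine setIntegral_congr_fun hsm fun w hw => ?_
  simp only [abs_det_restrictScalars, det_smulRight_one]
  exact mobMonomial_transform ha0 ha1 k h (mem_ball_zero_iff.1 (hs hw))

/-- Integrating a holomorphic function against `mobMonomial a k` over the pseudo-hyperbolic disc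
instead of the unit disc multiplies the integral by a constant. -/
lemma integral_mobDisc (ha0 : 0 < a) (ha1 : a < 1) (k : ℕ) {h : ℂ → ℂ}
    (hh : DifferentiableOn ℂ h (ball 0 1))
    (hint : IntegrableOn (fun z => conj (mobMonomial a k z) * h z) (ball 0 1)) :
    ∫ z in mobDisc a, conj (mobMonomial a k z) * h z =
      (1 / 2 : ℂ) ^ (2 * k + 2) * ∫ z in ball (0 : ℂ) 1, conj (mobMonomial a k z) * h z := by
  have hsub : closedBall (0 : ℂ) (1 / 2) ⊆ ball 0 1 := closedBall_subset_ball (by norm_num)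
  rw [← mob_image_closedBall ha0 ha1]
  conv_rhs => rw [← mob_image_ball ha0 ha1]
  rw [integral_mobMonomial_image ha0 ha1 k h isClosed_closedBall.measurableSet hsub,
    integral_mobMonomial_image ha0 ha1 k h isOpen_ball.measurableSet subset_rfl]
  have := integral_closedBall_eq_mul_integral_ball
    (h := fun w => h (mob a w) * ((1 - a * w) ^ 2)⁻¹) ?_ k ?_ (r := 1 / 2) (by norm_num)
    (by norm_num)
  · simpa using this
  · intro w hw
    have hw1 := mem_ball_zero_iff.1 hw
    refine DifferentiableWithinAt.mul ?_ ?_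
    · exact (hh.differentiableAt (isOpen_ball.mem_nhds
        (mem_ball_zero_iff.2 (norm_mob_lt_one ha0 ha1 hw1)))).comp_differentiableWithinAt w
        (hasDerivAt_mob ha0 ha1 hw1).differentiableAt.differentiableWithinAt
    · refine DifferentiableAt.differentiableWithinAt ?_
      exact DifferentiableAt.inv (by fun_prop)
        (pow_ne_zero 2 (one_sub_mul_ne_zero ha0 ha1 hw1))
  · rw [← mob_image_ball ha0 ha1, integrableOn_image_iff_integrableOn_abs_det_fderiv_smul volume
      isOpen_ball.measurableSet (hasFDerivWithinAt_mob ha0 ha1 subset_rfl) (mob_injOn ha0 ha1)] at hint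
    refine hint.congr_fun (fun w hw => ?_) isOpen_ball.measurableSet
    simp only [abs_det_restrictScalars, det_smulRight_one]
    exact mobMonomial_transform ha0 ha1 k h (mem_ball_zero_iff.1 hw)

end Moebius

/-! ### Several variables: restriction to `mobPolydisc` acts on `antiKernel` as a scalar. -/

section ProductDomain

open ComplexConjugate Metric Set

lemma isOpen_polydisc (n : ℕ) : IsOpen (polydisc n) := by
  have : polydisc n = ⋂ i, {z | ‖z i‖ < 1} := by ext; simp [polydisc]
  rw [this]
  exact isOpen_iInter_of_finite fun i => isOpen_lt (by fun_prop) continuous_const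

lemma polydisc_eq_pi (n : ℕ) : polydisc n = Set.pi univ fun _ => ball 0 1 := by
  ext; simp [polydisc]

lemma volume_polydisc_lt_top (n : ℕ) : volume (polydisc n) < ⊤ := by
  rw [polydisc_eq_pi, volume_pi_pi]
  exact ENNReal.prod_lt_top fun i _ => measure_ball_lt_top

instance instIsFiniteMeasurePolydisc (n : ℕ) : IsFiniteMeasure (volume.restrict (polydisc n)) :=
  ⟨by simpa using volume_polydisc_lt_top n⟩

/-- Fubini in the `i`-th coordinate; almost every slice is integrable, so the slice identity is
needed only for those. -/
lemma setIntegral_coord_eq_mul {m : ℕ} (i : Fin (m + 1)) {G : (Fin (m + 1) → ℂ) → ℂ}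
    (hG : Integrable G) {Δ : Set ℂ} (hΔ : MeasurableSet Δ) (c : ℂ)
    (hslice : ∀ z' : Fin m → ℂ, Integrable (fun t => G (i.insertNth t z')) →
      ∫ t in Δ, G (i.insertNth t z') = c * ∫ t, G (i.insertNth t z')) :
    ∫ z in {z | z i ∈ Δ}, G z = c * ∫ z, G z := by
  have hmp := (volume_preserving_piFinSuccAbove (fun _ : Fin (m + 1) => ℂ) i).symm
  have hemb := (MeasurableEquiv.piFinSuccAbove (fun _ : Fin (m + 1) => ℂ) i).symm.measurableEmbedding
  have hmeas : MeasurableSet {z : Fin (m + 1) → ℂ | z i ∈ Δ} := measurable_pi_apply i hΔ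
  have hsymm : ∀ p : ℂ × (Fin m → ℂ),
      (MeasurableEquiv.piFinSuccAbove (fun _ : Fin (m + 1) => ℂ) i).symm p =
        i.insertNth p.1 p.2 := fun p => rfl
  rw [← integral_indicator hmeas, ← hmp.integral_comp hemb, ← hmp.integral_comp hemb G]
  have hI : Integrable (fun p : ℂ × (Fin m → ℂ) => G (i.insertNth p.1 p.2)) :=
    (hmp.integrable_comp_emb hemb).2 hG
  have hI2 : Integrable (fun p : ℂ × (Fin m → ℂ) =>
      ({z | z i ∈ Δ} : Set (Fin (m + 1) → ℂ)).indicator G (i.insertNth p.1 p.2)) :=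
    (hmp.integrable_comp_emb hemb).2 (hG.indicator hmeas)
  simp_rw [hsymm]
  rw [Measure.volume_eq_prod] at hI hI2 ⊢
  rw [integral_prod_symm _ hI, integral_prod_symm _ hI2, ← integral_const_mul]
  refine integral_congr_ae ?_
  filter_upwards [hI.prod_left_ae] with z' hz'
  rw [← hslice z' hz', ← integral_indicator hΔ]
  refine integral_congr_ae (Filter.Eventually.of_forall fun t => ?_)
  beta_reduce
  by_cases ht : t ∈ Δ
  · rw [indicator_of_mem ht, indicator_of_mem (by simpa using ht)]
  · rw [indicator_of_notMem ht, indicator_of_notMem (by simpa using ht)]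

/-- The product of the pseudo-hyperbolic discs. -/
def mobPolydisc (n : ℕ) (a : ℝ) : Set (Fin n → ℂ) := {z | ∀ i, z i ∈ mobDisc a}

lemma mobPolydisc_eq_pi (n : ℕ) (a : ℝ) : mobPolydisc n a = Set.pi univ fun _ => mobDisc a := by
  ext; simp [mobPolydisc]

lemma isCompact_mobPolydisc (n : ℕ) {a : ℝ} (ha0 : 0 < a) (ha1 : a < 1) :
    IsCompact (mobPolydisc n a) := by
  rw [mobPolydisc_eq_pi]
  exact isCompact_univ_pi fun _ => isCompact_mobDisc ha0 ha1

lemma mobPolydisc_subset (n : ℕ) {a : ℝ} (ha0 : 0 < a) (ha1 : a < 1) :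
    mobPolydisc n a ⊆ polydisc n := fun _ hz i => norm_lt_one_of_mem_mobDisc ha0 ha1 (hz i)

variable {a : ℝ}

lemma norm_one_sub_mul_ge (ha0 : 0 < a) {z : ℂ} (hz : ‖z‖ < 1) :
    1 - a ≤ ‖1 - (a : ℂ) * z‖ := by
  have h1 := norm_sub_norm_le (1 : ℂ) ((a : ℂ) * z)
  rw [norm_one, norm_mul, Complex.norm_real, Real.norm_eq_abs, abs_of_pos ha0] at h1
  nlinarith

lemma norm_mobMonomial_le (ha0 : 0 < a) (ha1 : a < 1) (k : ℕ) {z : ℂ} (hz : ‖z‖ < 1) :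
    ‖mobMonomial a k z‖ ≤ ((1 - a) ^ 2)⁻¹ := by
  rw [mobMonomial, norm_mul, norm_pow, norm_inv, norm_pow, ← one_mul ((1 - a) ^ 2)⁻¹]
  have h1 : 0 < 1 - a := by linarith
  gcongr
  · exact pow_le_one₀ (norm_nonneg _) (norm_mob_lt_one ha0 ha1 hz).le
  · exact norm_one_sub_mul_ge ha0 hz

lemma continuousAt_mobMonomial (ha0 : 0 < a) (ha1 : a < 1) (k : ℕ) {z : ℂ} (hz : ‖z‖ < 1) :
    ContinuousAt (mobMonomial a k) z := by
  unfold mobMonomial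
  refine ((hasDerivAt_mob ha0 ha1 hz).continuousAt.pow k).mul (ContinuousAt.inv₀ (by fun_prop) ?_)
  exact pow_ne_zero 2 (one_sub_mul_ne_zero ha0 ha1 hz)

/-- The product of the functions `mobMonomial a (k i)` in the separate variables. -/
noncomputable def mobProd {n : ℕ} (a : ℝ) (k : Fin n → ℕ) (z : Fin n → ℂ) : ℂ :=
  ∏ i, mobMonomial a (k i) (z i)

lemma continuousOn_mobProd (ha0 : 0 < a) (ha1 : a < 1) {n : ℕ} (k : Fin n → ℕ) :
    ContinuousOn (mobProd a k) (polydisc n) := by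
  intro z hz
  refine ContinuousAt.continuousWithinAt ?_
  unfold mobProd
  refine tendsto_finsetProd _ fun i _ => ?_
  exact ContinuousAt.comp (f := fun w : Fin n → ℂ => w i)
    (continuousAt_mobMonomial ha0 ha1 (k i) (hz i)) (continuous_apply i).continuousAt

lemma norm_mobProd_le (ha0 : 0 < a) (ha1 : a < 1) {n : ℕ} (k : Fin n → ℕ) {z : Fin n → ℂ}
    (hz : z ∈ polydisc n) : ‖mobProd a k z‖ ≤ (((1 - a) ^ 2)⁻¹) ^ n := by
  rw [mobProd, norm_prod]
  refine (Finset.prod_le_prod (fun i _ => norm_nonneg _)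
    fun i _ => norm_mobMonomial_le ha0 ha1 (k i) (hz i)).trans ?_
  simp

lemma integrableOn_conj_mobProd_mul (ha0 : 0 < a) (ha1 : a < 1) {n : ℕ} (k : Fin n → ℕ)
    {u : (Fin n → ℂ) → ℂ} (hu : MemLp u 2 (volume.restrict (polydisc n))) :
    IntegrableOn (fun z => conj (mobProd a k z) * u z) (polydisc n) := by
  have h1 : Integrable u (volume.restrict (polydisc n)) := hu.integrable (by norm_num)
  refine Integrable.bdd_mul (c := (((1 - a) ^ 2)⁻¹) ^ n) h1 ?_ ?_
  · exact (Complex.continuous_conj.comp_continuousOn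
      (continuousOn_mobProd ha0 ha1 k)).aestronglyMeasurable (isOpen_polydisc n).measurableSet
  · refine (ae_restrict_iff' (isOpen_polydisc n).measurableSet).2
      (Filter.Eventually.of_forall fun z hz => ?_)
    simpa using norm_mobProd_le ha0 ha1 k hz

lemma integral_mobPolydisc_mobProd (ha0 : 0 < a) (ha1 : a < 1) {m : ℕ} (k : Fin (m + 1) → ℕ)
    {u : (Fin (m + 1) → ℂ) → ℂ} (hud : DifferentiableOn ℂ u (polydisc (m + 1)))
    (hu : MemLp u 2 (volume.restrict (polydisc (m + 1)))) :
    ∫ z in mobPolydisc (m + 1) a, conj (mobProd a k z) * u z =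
      (∏ i, (1 / 2 : ℂ) ^ (2 * k i + 2)) *
        ∫ z in polydisc (m + 1), conj (mobProd a k z) * u z := by
  have hD := (isOpen_polydisc (m + 1)).measurableSet
  have hΔ : MeasurableSet (mobDisc a) := (isClosed_mobDisc a).measurableSet
  set g := (polydisc (m + 1)).indicator fun z => conj (mobProd a k z) * u z with hg
  have hgi : Integrable g :=
    (integrable_indicator_iff hD).2 (integrableOn_conj_mobProd_mul ha0 ha1 k hu)
  have hT : ∀ S : Finset (Fin (m + 1)), MeasurableSet {z : Fin (m + 1) → ℂ | ∀ j ∈ S, z j ∈ mobDisc a} := by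
    intro S
    have : {z : Fin (m + 1) → ℂ | ∀ j ∈ S, z j ∈ mobDisc a} =
        ⋂ j ∈ S, {z | z j ∈ mobDisc a} := by ext; simp
    rw [this]
    exact Finset.measurableSet_biInter _ fun j _ => measurable_pi_apply j hΔ
  have key : ∀ S : Finset (Fin (m + 1)), ∫ z in {z | ∀ j ∈ S, z j ∈ mobDisc a}, g z =
      (∏ i ∈ S, (1 / 2 : ℂ) ^ (2 * k i + 2)) * ∫ z, g z := by
    intro S
    -- The coordinates are confined to `mobDisc a` one at a time, each giving its own factor.
    induction S using Finset.induction_on with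
    | empty => simp
    | insert i S hi ih =>
      rw [Finset.prod_insert hi, mul_assoc, ← ih, ← integral_indicator (hT S),
        ← setIntegral_coord_eq_mul i (hgi.indicator (hT S)) hΔ]
      · rw [setIntegral_indicator (hT S)]
        congr 2
        ext z
        simp
      · intro z' hz'
        -- Unless the frozen coordinates lie in the disc, and the already confined ones in `mobDisc
        -- a`, the slice vanishes identically.
        by_cases hc : (∀ j, ‖z' j‖ < 1) ∧ (∀ j, i.succAbove j ∈ S → z' j ∈ mobDisc a)
        · set h : ℂ → ℂ := fun t => (∏ j, conj (mobMonomial a (k (i.succAbove j)) (z' j))) *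
            u (i.insertNth t z') with hh
          have hGh : (fun t => ({z | ∀ j ∈ S, z j ∈ mobDisc a} : Set (Fin (m + 1) → ℂ)).indicator g
              (i.insertNth t z')) =
              (ball (0 : ℂ) 1).indicator fun t => conj (mobMonomial a (k i) t) * h t := by
            funext t
            have m1 : (i.insertNth t z' : Fin (m + 1) → ℂ) ∈
                ({z | ∀ j ∈ S, z j ∈ mobDisc a} : Set (Fin (m + 1) → ℂ)) := by
              intro j hj
              induction j using Fin.succAboveCases i with
              | x => exact absurd hj hi
              | p j => simpa using hc.2 j hj
            have m2 : (i.insertNth t z' : Fin (m + 1) → ℂ) ∈ polydisc (m + 1) ↔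
                t ∈ ball (0 : ℂ) 1 := by
              rw [polydisc, mem_ofPred_eq, Fin.forall_iff_succAbove i]
              simpa using fun _ => hc.1
            rw [indicator_of_mem m1, hg]
            by_cases ht : t ∈ ball (0 : ℂ) 1
            · rw [indicator_of_mem ht, indicator_of_mem (m2.2 ht), mobProd,
                Fin.prod_univ_succAbove _ i, hh]
              simp only [Fin.insertNth_apply_same, Fin.insertNth_apply_succAbove, map_mul, map_prod]
              ring
            · rw [indicator_of_notMem ht, indicator_of_notMem (fun hmem => ht (m2.1 hmem))]
          have hball : MeasurableSet (ball (0 : ℂ) 1) := isOpen_ball.measurableSet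
          have hsub : mobDisc a ∩ ball 0 1 = mobDisc a := inter_eq_left.2 fun t ht =>
            mem_ball_zero_iff.2 (norm_lt_one_of_mem_mobDisc ha0 ha1 ht)
          rw [hGh] at hz' ⊢
          rw [setIntegral_indicator hball, integral_indicator hball, hsub]
          refine integral_mobDisc ha0 ha1 (k i) ?_ ((integrable_indicator_iff hball).1 hz')
          refine DifferentiableOn.const_mul (hud.comp ?_ ?_) _
          · refine Differentiable.differentiableOn ?_
            rw [differentiable_pi]
            intro j
            induction j using Fin.succAboveCases i with
            | x => simp
            | p j => simp
          · intro t ht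
            change ∀ j, _
            rw [Fin.forall_iff_succAbove i]
            simpa using ⟨mem_ball_zero_iff.1 ht, hc.1⟩
        · have hzero : ∀ t, ({z | ∀ j ∈ S, z j ∈ mobDisc a} : Set (Fin (m + 1) → ℂ)).indicator g
              (i.insertNth t z') = 0 := by
            intro t
            by_contra hne
            apply hc
            have h1 := mem_of_indicator_ne_zero hne
            rw [indicator_of_mem h1] at hne
            have h2 := mem_of_indicator_ne_zero hne
            constructor
            · intro j; simpa using h2 (i.succAbove j)
            · intro j hj; simpa using h1 (i.succAbove j) hj
          simp [hzero]
  have h := key Finset.univ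
  simp only [Finset.mem_univ, true_imp_iff] at h
  rw [hg, setIntegral_indicator hD, integral_indicator hD] at h
  rwa [show ({z : Fin (m + 1) → ℂ | ∀ j, z j ∈ mobDisc a} ∩ polydisc (m + 1)) =
    mobPolydisc (m + 1) a from inter_eq_left.2 (mobPolydisc_subset _ ha0 ha1)] at h

/-- The product `∏ (1 - a z_i)`. -/
noncomputable def den {n : ℕ} (a : ℝ) (z : Fin n → ℂ) : ℂ := ∏ i, (1 - (a : ℂ) * z i)

/-- The antisymmetric holomorphic function `V(z) ∏ (1 - a z_i)^{-(n+1)}`. -/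
noncomputable def antiKernel {n : ℕ} (a : ℝ) (z : Fin n → ℂ) : ℂ :=
  vand z * (den a z ^ (n + 1))⁻¹

lemma den_ne_zero (ha0 : 0 < a) (ha1 : a < 1) {n : ℕ} {z : Fin n → ℂ} (hz : z ∈ polydisc n) :
    den a z ≠ 0 :=
  Finset.prod_ne_zero_iff.2 fun i _ => one_sub_mul_ne_zero ha0 ha1 (hz i)

/-- The differences `mob a (z j) - mob a (z i)` equal `-(1 - a²)(z j - z i)` over the two
denominators. Hence the Vandermonde determinant of the points `mob a (z i)` is a constant times
`vand z` over a power of `den`; the Leibniz expansion of its homogeneous form gives the sum. -/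
lemma sum_sign_mobProd (ha0 : 0 < a) (ha1 : a < 1) (n : ℕ) :
    ∃ κ : ℂ, κ ≠ 0 ∧ ∀ z ∈ polydisc n, antiKernel a z =
      ∑ σ : Equiv.Perm (Fin n), κ * (Equiv.Perm.sign σ : ℂ) * mobProd a (fun i => (σ i : ℕ)) z := by
  set κ : ℂ := ∏ i : Fin n, ∏ j ∈ Finset.Ioi i, (-(1 - (a : ℂ) ^ 2)) with hκ
  have hκ0 : κ ≠ 0 := Finset.prod_ne_zero_iff.2 fun i _ => Finset.prod_ne_zero_iff.2 fun j _ =>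
    neg_ne_zero.2 (one_sub_sq_ne_zero ha0 ha1)
  refine ⟨κ⁻¹, inv_ne_zero hκ0, fun z hz => ?_⟩
  have hd := den_ne_zero ha0 ha1 hz
  have h1 := Matrix.det_projVandermonde (fun i => (a : ℂ) - z i) (fun i => 1 - (a : ℂ) * z i)
  have h2 : (∏ i : Fin n, ∏ j ∈ Finset.Ioi i, (((a : ℂ) - z j) * (1 - (a : ℂ) * z i) -
      ((a : ℂ) - z i) * (1 - (a : ℂ) * z j))) = κ * vand z := by
    rw [vand_eq_prod, hκ, ← Finset.prod_mul_distrib]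
    refine Finset.prod_congr rfl fun i _ => ?_
    rw [← Finset.prod_mul_distrib]
    refine Finset.prod_congr rfl fun j _ => ?_
    ring
  rw [h2, ← Matrix.det_transpose, Matrix.det_apply'] at h1
  have h3 : ∀ σ : Equiv.Perm (Fin n), ∏ i, (Matrix.projVandermonde (fun i => (a : ℂ) - z i)
      (fun i => 1 - (a : ℂ) * z i)).transpose (σ i) i =
      mobProd a (fun i => (σ i : ℕ)) z * den a z ^ (n + 1) := by
    intro σ
    rw [mobProd, den, ← Finset.prod_pow, ← Finset.prod_mul_distrib]
    refine Finset.prod_congr rfl fun i _ => ?_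
    have hi := one_sub_mul_ne_zero ha0 ha1 (hz i)
    rw [Matrix.transpose_apply, Matrix.projVandermonde_apply, mobMonomial, mob, Fin.val_rev]
    have hlt := (σ i).isLt
    -- The powers of `1 - a z i`: from the homogenized Vandermonde entry, from the denominator of
    -- `mob`, and from the factor in `mobMonomial`.
    have e : n + 1 = (n - ((σ i : ℕ) + 1)) + (σ i : ℕ) + 2 := by omega
    rw [e, pow_add, pow_add]
    field_simp
    rw [← mul_pow, div_mul_cancel₀ _ hi]
  simp_rw [h3] at h1
  rw [antiKernel]
  have h4 : vand z = κ⁻¹ * ∑ σ : Equiv.Perm (Fin n), ((Equiv.Perm.sign σ : ℤ) : ℂ) *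
      (mobProd a (fun i => (σ i : ℕ)) z * den a z ^ (n + 1)) := by
    rw [h1]; field_simp
  rw [h4, Finset.mul_sum, Finset.sum_mul]
  refine Finset.sum_congr rfl fun σ _ => ?_
  field_simp

/-- The factor by which `antiKernel` is multiplied when its restriction to `mobPolydisc` is
projected to the Bergman space. -/
noncomputable def projFactor (n : ℕ) : ℝ := ∏ j : Fin n, (1 / 2 : ℝ) ^ (2 * (j : ℕ) + 2)

lemma projFactor_pos (n : ℕ) : 0 < projFactor n := Finset.prod_pos fun j _ => by positivity

/-- The exponents in each term of `sum_sign_mobProd` are a permutation of `0, …, m`, so all terms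
acquire the same factor. Since `u` is an arbitrary element of the Bergman space, this computes the
projection of the truncated kernel. -/
lemma integral_mobPolydisc_antiKernel (ha0 : 0 < a) (ha1 : a < 1) {m : ℕ}
    {u : (Fin (m + 1) → ℂ) → ℂ} (hud : DifferentiableOn ℂ u (polydisc (m + 1)))
    (hu : MemLp u 2 (volume.restrict (polydisc (m + 1)))) :
    ∫ z in mobPolydisc (m + 1) a, conj (antiKernel a z) * u z =
      (projFactor (m + 1) : ℂ) * ∫ z in polydisc (m + 1), conj (antiKernel a z) * u z := by
  obtain ⟨κ, -, hκ⟩ := sum_sign_mobProd ha0 ha1 (m + 1)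
  have hE := (isCompact_mobPolydisc (m + 1) ha0 ha1).isClosed.measurableSet
  have hD := (isOpen_polydisc (m + 1)).measurableSet
  have hsub := mobPolydisc_subset (m + 1) ha0 ha1
  have hI : ∀ σ : Equiv.Perm (Fin (m + 1)), IntegrableOn
      (fun z => conj (κ * (Equiv.Perm.sign σ : ℂ)) *
        (conj (mobProd a (fun i => (σ i : ℕ)) z) * u z)) (polydisc (m + 1)) :=
    fun σ => (integrableOn_conj_mobProd_mul ha0 ha1 _ hu).const_mul _
  have hexp : ∀ s ⊆ polydisc (m + 1), MeasurableSet s →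
      ∫ z in s, conj (antiKernel a z) * u z = ∑ σ : Equiv.Perm (Fin (m + 1)),
        conj (κ * (Equiv.Perm.sign σ : ℂ)) *
          ∫ z in s, conj (mobProd a (fun i => (σ i : ℕ)) z) * u z := by
    intro s hs hsm
    simp_rw [← integral_const_mul]
    rw [← integral_finsetSum _ fun σ _ => (hI σ).mono_set hs]
    refine setIntegral_congr_fun hsm fun z hz => ?_
    simp only [hκ z (hs hz), map_sum, map_mul, Finset.sum_mul]
    exact Finset.sum_congr rfl fun σ _ => by ring
  rw [hexp _ hsub hE, hexp _ subset_rfl hD, Finset.mul_sum]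
  refine Finset.sum_congr rfl fun σ _ => ?_
  rw [integral_mobPolydisc_mobProd ha0 ha1 _ hud hu]
  have : ∏ i : Fin (m + 1), (1 / 2 : ℂ) ^ (2 * (σ i : ℕ) + 2) = (projFactor (m + 1) : ℂ) := by
    rw [Equiv.prod_comp σ (fun j : Fin (m + 1) => (1 / 2 : ℂ) ^ (2 * (j : ℕ) + 2)), projFactor]
    push_cast
    rfl
  rw [this]
  ring

end ProductDomain

/-! ### Logarithmic growth of the test integral relative to `mobPolydisc`. -/

section Growth

open Metric Set

/-- The number of pairs `i < j` in `Fin n`. -/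
def pairCount (n : ℕ) : ℕ := ∑ i : Fin n, (Finset.Ioi i).card

lemma pairCount_succ (m : ℕ) : pairCount (m + 1) = m + pairCount m := by
  unfold pairCount
  rw [Fin.sum_univ_succ]
  simp only [Fin.card_Ioi]
  congr 1
  refine Finset.sum_congr rfl fun i _ => ?_
  simp only [Fin.val_succ]
  omega

lemma norm_vand_le {n : ℕ} {z : Fin n → ℂ} {c : ℝ} (h : ∀ i j, ‖z i - z j‖ ≤ c) :
    ‖vand z‖ ≤ c ^ pairCount n := by
  rw [vand_eq_prod, norm_prod, pairCount, ← Finset.prod_pow_eq_pow_sum]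
  refine Finset.prod_le_prod (fun i _ => norm_nonneg _) fun i _ => ?_
  rw [norm_prod, ← Finset.prod_const]
  exact Finset.prod_le_prod (fun j _ => norm_nonneg _) fun j _ => h j i

lemma le_norm_vand {n : ℕ} {z : Fin n → ℂ} {c : ℝ} (hc : 0 ≤ c)
    (h : ∀ i j, i ≠ j → c ≤ ‖z i - z j‖) : c ^ pairCount n ≤ ‖vand z‖ := by
  rw [vand_eq_prod, norm_prod, pairCount, ← Finset.prod_pow_eq_pow_sum]
  refine Finset.prod_le_prod (fun i _ => pow_nonneg hc _) fun i _ => ?_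
  rw [norm_prod, ← Finset.prod_const]
  exact Finset.prod_le_prod (fun j _ => hc) fun j hj => h j i (Finset.mem_Ioi.1 hj).ne'

lemma vand_succ {m : ℕ} (z : Fin (m + 1) → ℂ) :
    vand z = (∏ j : Fin m, (z j.succ - z 0)) * vand fun j : Fin m => z j.succ := by
  simp only [vand_eq_prod]
  rw [Fin.prod_univ_succ, Fin.prod_Ioi_zero]
  simp_rw [Fin.prod_Ioi_succ]

/-- The density `|V|² ∏ |1 - a z_i|^{-2n}` whose integral is compared over the polydisc and over
`mobPolydisc`. -/
noncomputable def testDensity {n : ℕ} (a : ℝ) (z : Fin n → ℂ) : ℝ :=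
  ‖vand z‖ ^ 2 * (‖den a z‖ ^ (2 * n))⁻¹

lemma testDensity_nonneg {n : ℕ} (a : ℝ) (z : Fin n → ℂ) : 0 ≤ testDensity a z := by
  unfold testDensity; positivity

lemma mem_mobDisc_estimates {a : ℝ} (ha0 : 0 < a) (ha1 : a < 1) {z : ℂ} (hz : z ∈ mobDisc a) :
    ‖z - a‖ ≤ 2 * (1 - a) ∧ (1 - a) / 2 ≤ ‖1 - (a : ℂ) * z‖ := by
  have h : ‖(a : ℂ) - z‖ ≤ 1 / 2 * ‖1 - (a : ℂ) * z‖ := hz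
  have e : 1 - (a : ℂ) * z = ((1 - a ^ 2 : ℝ) : ℂ) + a * (a - z) := by push_cast; ring
  have hn : ‖((1 - a ^ 2 : ℝ) : ℂ)‖ = 1 - a ^ 2 := by
    rw [Complex.norm_real, Real.norm_eq_abs, abs_of_pos (by nlinarith)]
  have hm : ‖(a : ℂ) * (a - z)‖ = a * ‖(a : ℂ) - z‖ := by
    rw [norm_mul, Complex.norm_real, Real.norm_eq_abs, abs_of_pos ha0]
  have h1 : ‖1 - (a : ℂ) * z‖ ≤ (1 - a ^ 2) + a * ‖(a : ℂ) - z‖ := by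
    rw [e]; exact (norm_add_le _ _).trans_eq (by rw [hn, hm])
  have h0 := norm_nonneg ((a : ℂ) - z)
  have hle : a * ‖(a : ℂ) - z‖ ≤ ‖(a : ℂ) - z‖ := by nlinarith
  refine ⟨?_, ?_⟩
  · rw [norm_sub_rev]; nlinarith
  · have h2 := norm_sub_le (1 - (a : ℂ) * z) ((a : ℂ) * (a - z))
    rw [show 1 - (a : ℂ) * z - (a : ℂ) * (a - z) = ((1 - a ^ 2 : ℝ) : ℂ) by push_cast; ring,
      hn, hm] at h2
    nlinarith

lemma volume_ball_eq_ofReal (c : ℂ) {r : ℝ} (hr : 0 ≤ r) :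
    volume (ball c r) = ENNReal.ofReal (r ^ 2 * Real.pi) := by
  rw [Complex.volume_ball, ENNReal.ofReal_mul (by positivity), ENNReal.ofReal_pow hr]
  congr 1
  exact (ENNReal.ofReal_coe_nnreal (p := NNReal.pi)).symm

lemma volume_closedBall_eq_ofReal (c : ℂ) {r : ℝ} (hr : 0 ≤ r) :
    volume (closedBall c r) = ENNReal.ofReal (r ^ 2 * Real.pi) := by
  rw [← volume_ball_eq_ofReal c hr, Complex.volume_closedBall, Complex.volume_ball]

/-- The common order of magnitude of the integrals in this section. -/
noncomputable def scaleFactor (m : ℕ) (s : ℝ) : ℝ :=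
  s ^ (2 * pairCount m) * s ^ (2 * m) / s ^ (2 * (m + 1) * m)

/-- Sup bound times volume: with `s = 1 - a`, coordinates differ by at most `4s`, denominators are
at least `s/2`, and each factor lies in a disc of radius `2s`. -/
lemma lintegral_mobPolydisc_le (m : ℕ) : ∃ κ : ℝ, 0 < κ ∧ ∀ a : ℝ, 0 < a → a < 1 →
    ∫⁻ z in mobPolydisc (m + 1) a, ENNReal.ofReal (testDensity a z) ≤
      ENNReal.ofReal (κ * scaleFactor m (1 - a)) := by
  refine ⟨4 ^ (2 * (m + pairCount m)) * 2 ^ (2 * (m + 1) * (m + 1)) * (4 * Real.pi) ^ (m + 1),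
    by positivity, fun a ha0 ha1 => ?_⟩
  set s := 1 - a with hs
  have hs0 : 0 < s := by linarith
  have hE := (isCompact_mobPolydisc (m + 1) ha0 ha1).isClosed.measurableSet
  set Y : ℝ := ((4 * s) ^ pairCount (m + 1)) ^ 2 * (((s / 2) ^ (m + 1)) ^ (2 * (m + 1)))⁻¹ with hY
  have hY0 : 0 ≤ Y := by positivity
  have hbound : ∀ z ∈ mobPolydisc (m + 1) a, testDensity a z ≤ Y := by
    intro z hz
    have h1 : ‖vand z‖ ≤ (4 * s) ^ pairCount (m + 1) := by
      refine norm_vand_le fun i j => ?_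
      have hi := (mem_mobDisc_estimates ha0 ha1 (hz i)).1
      have hj := (mem_mobDisc_estimates ha0 ha1 (hz j)).1
      calc ‖z i - z j‖ = ‖(z i - a) - (z j - a)‖ := by congr 1; ring
        _ ≤ ‖z i - a‖ + ‖z j - a‖ := norm_sub_le _ _
        _ ≤ 4 * s := by linarith
    have h2 : (s / 2) ^ (m + 1) ≤ ‖den a z‖ := by
      rw [den, norm_prod]
      have := Finset.prod_le_prod (s := (Finset.univ : Finset (Fin (m + 1))))
        (f := fun _ => s / 2) (g := fun i => ‖1 - (a : ℂ) * z i‖) (fun i _ => by positivity)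
        (fun i _ => (mem_mobDisc_estimates ha0 ha1 (hz i)).2)
      rwa [Finset.prod_const, Finset.card_univ, Fintype.card_fin] at this
    unfold testDensity
    rw [hY]
    gcongr
  have hvol : volume (mobPolydisc (m + 1) a) ≤ ENNReal.ofReal (((2 * s) ^ 2 * Real.pi) ^ (m + 1)) := by
    have hsub : mobPolydisc (m + 1) a ⊆ Set.pi univ fun _ => closedBall (a : ℂ) (2 * s) := by
      intro z hz i _
      rw [mem_closedBall, dist_eq_norm]
      exact (mem_mobDisc_estimates ha0 ha1 (hz i)).1
    refine (measure_mono hsub).trans ?_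
    rw [volume_pi_pi]
    simp_rw [volume_closedBall_eq_ofReal (a : ℂ) (by positivity : 0 ≤ 2 * s)]
    rw [Finset.prod_const, Finset.card_univ, Fintype.card_fin, ENNReal.ofReal_pow (by positivity)]
  calc ∫⁻ z in mobPolydisc (m + 1) a, ENNReal.ofReal (testDensity a z)
      ≤ ∫⁻ z in mobPolydisc (m + 1) a, ENNReal.ofReal Y :=
        setLIntegral_mono' hE fun z hz => ENNReal.ofReal_le_ofReal (hbound z hz)
    _ = ENNReal.ofReal Y * volume (mobPolydisc (m + 1) a) := setLIntegral_const _ _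
    _ ≤ ENNReal.ofReal Y * ENNReal.ofReal (((2 * s) ^ 2 * Real.pi) ^ (m + 1)) := by gcongr
    _ = ENNReal.ofReal (Y * ((2 * s) ^ 2 * Real.pi) ^ (m + 1)) := (ENNReal.ofReal_mul hY0).symm
    _ = _ := by
      congr 1
      rw [hY, pairCount_succ, scaleFactor]
      simp only [mul_pow, div_pow, ← pow_mul]
      have h4 : ∀ e : ℕ, (4 : ℝ) ^ e = 2 ^ (2 * e) := fun e => by rw [pow_mul]; norm_num
      simp only [h4]
      field_simp
      ring

/-- The polydisc contains `L` disjoint boxes, one for each dyadic distance of `z 0` from 1, and each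
carries at least `κ * scaleFactor m (1 - a)`. -/
lemma le_lintegral_polydisc (m : ℕ) : ∃ κ : ℝ, 0 < κ ∧ ∀ L : ℕ, ∃ a : ℝ, 0 < a ∧ a < 1 ∧
    L * ENNReal.ofReal (κ * scaleFactor m (1 - a)) ≤
      ∫⁻ z in polydisc (m + 1), ENNReal.ofReal (testDensity a z) := by
  refine ⟨(1 / 2) ^ (2 * m) * (1 / 2) ^ (2 * pairCount m) /
    (2 ^ (2 * m + 2) * (m + 3) ^ (2 * (m + 1) * m)) * (Real.pi / 16) ^ (m + 1),
    by positivity, fun L => ?_⟩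
  -- Small enough that the cluster of the other `m` coordinates, of size `(m + 1) s`, stays within a
  -- quarter of every dyadic distance `t k`, `k < L`.
  set s : ℝ := (1 / 2) ^ L / (4 * (m + 1)) with hs
  have hs0 : 0 < s := by positivity
  have hsL : 4 * (m + 1) * s = (1 / 2) ^ L := by rw [hs]; field_simp
  have hpowL : ((1 : ℝ) / 2) ^ L ≤ 1 := pow_le_one₀ (by norm_num) (by norm_num)
  have hm0 : (0 : ℝ) ≤ m := Nat.cast_nonneg m
  have hms : (m + 1) * s ≤ 1 / 4 := by linarith
  have hs1 : s ≤ 1 / 4 := by nlinarith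
  refine ⟨1 - s, by linarith, by linarith, ?_⟩
  set a : ℝ := 1 - s with ha
  have hsa : 1 - a = s := by rw [ha]; ring
  rw [hsa]
  set t : ℕ → ℝ := fun k => (1 / 2) ^ k with ht
  have ht0 : ∀ k, 0 < t k := fun k => by positivity
  have ht1 : ∀ k, t k ≤ 1 := fun k => pow_le_one₀ (by norm_num) (by norm_num)
  -- Box `k` puts `z 0` near `1 - t k` and the other coordinates near the points `1 - s, …, 1 - m
  -- s`, whose spacing `s` against radii `s/4` keeps them at least `s/2` apart.
  set c : ℕ → Fin (m + 1) → ℂ := fun k => Fin.cons ((1 - t k : ℝ) : ℂ)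
    (fun j : Fin m => ((1 - ((j : ℕ) + 1) * s : ℝ) : ℂ)) with hc
  set ρ : ℕ → Fin (m + 1) → ℝ := fun k => Fin.cons (t k / 4) (fun _ : Fin m => s / 4) with hρ
  set box : ℕ → Set (Fin (m + 1) → ℂ) := fun k => Set.pi univ fun i => ball (c k i) (ρ k i) with hbox
  have hboxm : ∀ k, MeasurableSet (box k) := fun k =>
    MeasurableSet.univ_pi fun i => isOpen_ball.measurableSet
  have hmem : ∀ k, ∀ z ∈ box k, ‖z 0 - ((1 - t k : ℝ) : ℂ)‖ < t k / 4 ∧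
      ∀ j : Fin m, ‖z j.succ - ((1 - ((j : ℕ) + 1) * s : ℝ) : ℂ)‖ < s / 4 := by
    intro k z hz
    refine ⟨?_, fun j => ?_⟩
    · simpa [hc, hρ, dist_eq_norm] using hz 0 trivial
    · simpa [hc, hρ, dist_eq_norm] using hz j.succ trivial
  have hjm : ∀ j : Fin m, ((j : ℕ) : ℝ) + 1 ≤ m := fun j => by exact_mod_cast j.isLt
  have hnormle : ∀ (w : ℂ) (x r : ℝ), 0 ≤ x → ‖w - (x : ℂ)‖ < r → ‖w‖ < x + r := by
    intro w x r hx hw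
    have := norm_add_le (w - x) (x : ℂ)
    rw [sub_add_cancel, Complex.norm_real, Real.norm_eq_abs, abs_of_nonneg hx] at this
    linarith
  have hone : ∀ (w : ℂ) (x r : ℝ), 0 ≤ x → ‖w - ((1 - x : ℝ) : ℂ)‖ < r →
      ‖1 - w‖ < x + r ∧ x - r < ‖1 - w‖ := by
    intro w x r hx hw
    have e : 1 - w = (x : ℂ) - (w - ((1 - x : ℝ) : ℂ)) := by push_cast; ring
    have h1 := norm_sub_le (x : ℂ) (w - ((1 - x : ℝ) : ℂ))
    have h2 := norm_sub_norm_le (x : ℂ) (w - ((1 - x : ℝ) : ℂ))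
    rw [← e, Complex.norm_real, Real.norm_eq_abs, abs_of_nonneg hx] at h1 h2
    constructor <;> linarith
  have hden : ∀ w : ℂ, ‖w‖ < 1 → ‖1 - (a : ℂ) * w‖ ≤ ‖1 - w‖ + s := by
    intro w hw
    have e : 1 - (a : ℂ) * w = (1 - w) + (s : ℂ) * w := by rw [ha]; push_cast; ring
    rw [e]
    refine (norm_add_le _ _).trans ?_
    rw [norm_mul, Complex.norm_real, Real.norm_eq_abs, abs_of_pos hs0]
    nlinarith [norm_nonneg w]
  have hsub : ∀ k, box k ⊆ polydisc (m + 1) := by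
    intro k z hz
    obtain ⟨h0, hj⟩ := hmem k z hz
    change ∀ i, _
    rw [Fin.forall_fin_succ]
    refine ⟨?_, fun j => ?_⟩
    · have := hnormle _ _ _ (by linarith [ht1 k]) h0
      linarith [ht0 k]
    · have hjs : (((j : ℕ) : ℝ) + 1) * s ≤ m * s := by nlinarith [hjm j]
      have hjp : 0 ≤ ((j : ℕ) : ℝ) * s := by positivity
      have := hnormle _ _ _ (by nlinarith) (hj j)
      nlinarith
  have hdisj : (Finset.range L : Set ℕ).Pairwise (Function.onFun Disjoint box) := by
    have key : ∀ k l, k < l → Disjoint (box k) (box l) := by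
      intro k l hkl
      rw [Set.disjoint_left]
      intro z hz hz'
      have h1 := (hmem k z hz).1
      have h2 := (hmem l z hz').1
      have htl : t l ≤ t k / 2 := by
        have : t l ≤ t (k + 1) := pow_le_pow_of_le_one (by norm_num) (by norm_num) hkl
        have e : t (k + 1) = t k / 2 := by simp only [ht]; rw [pow_succ]; ring
        linarith
      have h3 := norm_sub_le (z 0 - ((1 - t k : ℝ) : ℂ)) (z 0 - ((1 - t l : ℝ) : ℂ))
      have e : (z 0 - ((1 - t k : ℝ) : ℂ)) - (z 0 - ((1 - t l : ℝ) : ℂ)) =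
          ((t k - t l : ℝ) : ℂ) := by push_cast; ring
      rw [e, Complex.norm_real, Real.norm_eq_abs, abs_of_pos (by linarith [ht0 k])] at h3
      linarith [ht0 k]
    intro k _ l _ hkl
    rcases lt_or_gt_of_ne hkl with h | h
    · exact key k l h
    · exact (key l k h).symm
  set X : ℕ → ℝ := fun k => ((t k / 2) ^ m * (s / 2) ^ pairCount m) ^ 2 *
    ((2 * t k * ((m + 3) * s) ^ m) ^ (2 * (m + 1)))⁻¹ with hX
  have hX0 : ∀ k, 0 ≤ X k := fun k => by have := ht0 k; positivity
  have hlow : ∀ k < L, ∀ z ∈ box k, X k ≤ testDensity a z := by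
    intro k hk z hz
    obtain ⟨h0, hj⟩ := hmem k z hz
    have hpd := hsub k hz
    have htk : 4 * (m + 1) * s ≤ t k := by
      rw [hsL]; exact pow_le_pow_of_le_one (by norm_num) (by norm_num) hk.le
    have htks : 4 * s ≤ t k := by nlinarith
    have h10 := hone _ _ _ (ht0 k).le h0
    have h1j : ∀ j : Fin m, ‖1 - z j.succ‖ < (m + 1) * s := by
      intro j
      have h1 := (hone _ (((j : ℕ) + 1) * s) _ (by positivity) (hj j)).1
      nlinarith [hjm j]
    have hv : (t k / 2) ^ m * (s / 2) ^ pairCount m ≤ ‖vand z‖ := by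
      rw [vand_succ, norm_mul, norm_prod]
      have hA : (t k / 2) ^ m ≤ ∏ j : Fin m, ‖z j.succ - z 0‖ := by
        have := Finset.prod_le_prod (s := (Finset.univ : Finset (Fin m)))
          (f := fun _ => t k / 2) (g := fun j => ‖z j.succ - z 0‖)
          (fun i _ => by linarith [ht0 k]) (fun j _ => by
            have h3 := norm_sub_norm_le (1 - z 0) (1 - z j.succ)
            rw [show 1 - z 0 - (1 - z j.succ) = z j.succ - z 0 by ring] at h3
            have := h1j j
            linarith [h10.2])
        rwa [Finset.prod_const, Finset.card_univ, Fintype.card_fin] at this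
      have hB : (s / 2) ^ pairCount m ≤ ‖vand fun j : Fin m => z j.succ‖ := by
        refine le_norm_vand (by positivity) fun i j hij => ?_
        have e : (z i.succ - ((1 - ((i : ℕ) + 1) * s : ℝ) : ℂ)) -
            (z j.succ - ((1 - ((j : ℕ) + 1) * s : ℝ) : ℂ)) - (z i.succ - z j.succ) =
            (((((i : ℕ) : ℝ) - ((j : ℕ) : ℝ)) * s : ℝ) : ℂ) := by push_cast; ring
        have h3 := norm_sub_le ((z i.succ - ((1 - ((i : ℕ) + 1) * s : ℝ) : ℂ)) -
            (z j.succ - ((1 - ((j : ℕ) + 1) * s : ℝ) : ℂ))) (z i.succ - z j.succ)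
        have h4 := norm_sub_le (z i.succ - ((1 - ((i : ℕ) + 1) * s : ℝ) : ℂ))
            (z j.succ - ((1 - ((j : ℕ) + 1) * s : ℝ) : ℂ))
        rw [e, Complex.norm_real, Real.norm_eq_abs, abs_mul, abs_of_pos hs0] at h3
        have h5 : (1 : ℝ) ≤ |((i : ℕ) : ℝ) - ((j : ℕ) : ℝ)| := by
          have hne : ((i : ℕ) : ℤ) - ((j : ℕ) : ℤ) ≠ 0 := by
            intro h; apply hij; ext; omega
          have := Int.one_le_abs hne
          exact_mod_cast this
        have := hj i
        have := hj j
        nlinarith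
      have := ht0 k
      gcongr
    have hd : ‖den a z‖ ≤ 2 * t k * ((m + 3) * s) ^ m := by
      rw [den, norm_prod, Fin.prod_univ_succ]
      have hA : ‖1 - (a : ℂ) * z 0‖ ≤ 2 * t k := by
        have := hden _ (hpd 0)
        linarith [h10.1, ht0 k]
      have hB : ∏ j : Fin m, ‖1 - (a : ℂ) * z j.succ‖ ≤ ((m + 3) * s) ^ m := by
        have := Finset.prod_le_prod (s := (Finset.univ : Finset (Fin m)))
          (f := fun j => ‖1 - (a : ℂ) * z j.succ‖) (g := fun _ => ((m : ℝ) + 3) * s)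
          (fun i _ => norm_nonneg _) (fun j _ => by
            have := hden _ (hpd j.succ)
            have := h1j j
            linarith)
        simpa using this
      have := ht0 k
      gcongr
    have hdpos : 0 < ‖den a z‖ := norm_pos_iff.2 (den_ne_zero (by linarith) (by linarith) hpd)
    have := ht0 k
    unfold testDensity
    simp only [hX]
    gcongr
  have hvol : ∀ k, volume (box k) = ENNReal.ofReal ((t k / 4) ^ 2 * Real.pi *
      ((s / 4) ^ 2 * Real.pi) ^ m) := by
    intro k
    have h4 : 0 ≤ t k / 4 := by linarith [ht0 k]
    rw [hbox, volume_pi_pi, Fin.prod_univ_succ]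
    simp only [hc, hρ, Fin.cons_zero, Fin.cons_succ]
    rw [volume_ball_eq_ofReal _ h4]
    simp_rw [volume_ball_eq_ofReal _ (by positivity : 0 ≤ s / 4)]
    rw [Finset.prod_const, Finset.card_univ, Fintype.card_fin,
      ENNReal.ofReal_mul (p := (t k / 4) ^ 2 * Real.pi) (by positivity),
      ENNReal.ofReal_pow (p := (s / 4) ^ 2 * Real.pi) (by positivity)]
  -- Independence of `k`: the powers of `t k` are `2m` from the Vandermonde product, `-2(m+1)` from
  -- the denominator and `2` from the volume, and they cancel.
  have hone_box : ∀ k < L, ENNReal.ofReal ((1 / 2) ^ (2 * m) * (1 / 2) ^ (2 * pairCount m) /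
    (2 ^ (2 * m + 2) * (m + 3) ^ (2 * (m + 1) * m)) * (Real.pi / 16) ^ (m + 1) *
      scaleFactor m s) ≤ ∫⁻ z in box k, ENNReal.ofReal (testDensity a z) := by
    intro k hk
    calc _ = ENNReal.ofReal (X k * ((t k / 4) ^ 2 * Real.pi * ((s / 4) ^ 2 * Real.pi) ^ m)) := by
          congr 1
          have := ht0 k
          simp only [hX]
          rw [scaleFactor]
          generalize t k = τ at *
          generalize (m : ℝ) + 3 = w at *
          simp only [mul_pow, div_pow, one_pow, ← pow_mul]
          have h16 : ∀ e : ℕ, (16 : ℝ) ^ e = 2 ^ (4 * e) := fun e => by rw [pow_mul]; norm_num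
          have h4 : ∀ e : ℕ, (4 : ℝ) ^ e = 2 ^ (2 * e) := fun e => by rw [pow_mul]; norm_num
          simp only [h16, h4]
          field_simp
          ring
      _ = ENNReal.ofReal (X k) * volume (box k) := by
          rw [ENNReal.ofReal_mul (hX0 k), hvol]
      _ = ∫⁻ z in box k, ENNReal.ofReal (X k) := (setLIntegral_const _ _).symm
      _ ≤ _ := setLIntegral_mono' (hboxm k) fun z hz => ENNReal.ofReal_le_ofReal (hlow k hk z hz)
  calc _ = ∑ k ∈ Finset.range L, ENNReal.ofReal ((1 / 2) ^ (2 * m) * (1 / 2) ^ (2 * pairCount m) /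
    (2 ^ (2 * m + 2) * (m + 3) ^ (2 * (m + 1) * m)) * (Real.pi / 16) ^ (m + 1) *
      scaleFactor m s) := by rw [Finset.sum_const, Finset.card_range, nsmul_eq_mul]
    _ ≤ ∑ k ∈ Finset.range L, ∫⁻ z in box k, ENNReal.ofReal (testDensity a z) :=
      Finset.sum_le_sum fun k hk => hone_box k (Finset.mem_range.1 hk)
    _ = ∫⁻ z in ⋃ k ∈ Finset.range L, box k, ENNReal.ofReal (testDensity a z) :=
      (lintegral_biUnion_finset hdisj (fun k _ => hboxm k) _).symm
    _ ≤ _ := lintegral_mono_set (iUnion₂_subset fun k _ => hsub k)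

/-- The integral of the test density over the polydisc is not controlled, uniformly in `a`, by
its integral over `mobPolydisc`. -/
lemma exists_mul_lintegral_mobPolydisc_lt (m : ℕ) (K : ℝ≥0) : ∃ a : ℝ, 0 < a ∧ a < 1 ∧
    K * ∫⁻ z in mobPolydisc (m + 1) a, ENNReal.ofReal (testDensity a z) <
      ∫⁻ z in polydisc (m + 1), ENNReal.ofReal (testDensity a z) := by
  obtain ⟨κ, hκ, hup⟩ := lintegral_mobPolydisc_le m
  obtain ⟨κ', hκ', hlow⟩ := le_lintegral_polydisc m
  obtain ⟨L, hL⟩ := exists_nat_gt (K * κ / κ')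
  obtain ⟨a, ha0, ha1, h⟩ := hlow L
  refine ⟨a, ha0, ha1, lt_of_lt_of_le ?_ h⟩
  have hS : 0 < scaleFactor m (1 - a) := by
    have : 0 < 1 - a := by linarith
    unfold scaleFactor; positivity
  calc _ ≤ K * ENNReal.ofReal (κ * scaleFactor m (1 - a)) := by gcongr; exact hup a ha0 ha1
    _ = ENNReal.ofReal (K * (κ * scaleFactor m (1 - a))) := by
      rw [ENNReal.ofReal_mul (p := (K : ℝ)) (by positivity), ENNReal.ofReal_coe_nnreal]
    _ < ENNReal.ofReal (L * (κ' * scaleFactor m (1 - a))) := by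
      rw [div_lt_iff₀ hκ'] at hL
      have hLpos : 0 < (L : ℝ) * κ' := lt_of_le_of_lt (by positivity) hL
      rw [ENNReal.ofReal_lt_ofReal_iff (by rw [← mul_assoc]; positivity)]
      nlinarith
    _ = _ := by rw [ENNReal.ofReal_mul (p := (L : ℝ)) (by positivity), ENNReal.ofReal_natCast]

end Growth

/-! ### From a norm bound to a comparison of test integrals. -/

section Duality

open ComplexConjugate Set

lemma eLpNorm_withDensity_eq {α : Type*} [MeasurableSpace α] {μ : Measure α} {p : ℝ} (hp : 0 < p)
    {W : α → ℝ} (hW : AEMeasurable W μ) {g : α → ℂ} (hg : AEStronglyMeasurable g μ) :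
    eLpNorm g (ENNReal.ofReal p) (μ.withDensity fun z => ENNReal.ofReal (W z)) =
      (∫⁻ z, ENNReal.ofReal (‖g z‖ ^ p * W z) ∂μ) ^ (1 / p) := by
  rw [eLpNorm_eq_lintegral_rpow_enorm_toReal (by simpa using hp) ENNReal.ofReal_ne_top,
    ENNReal.toReal_ofReal hp.le, lintegral_withDensity_eq_lintegral_mul₀ hW.ennreal_ofReal
    (hg.enorm.pow_const p)]
  congr 1
  refine lintegral_congr fun z => ?_
  rw [Pi.mul_apply, ENNReal.ofReal_mul (by positivity), mul_comm,
    ← ENNReal.ofReal_rpow_of_nonneg (norm_nonneg _) hp.le, ofReal_norm]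

/-- Hölder for `g W^(1/p)` and `F W^(-1/p)`; the dual weight is `W^(1-q)` because `-q/p = 1 - q`. -/
lemma lintegral_mul_le_weighted {α : Type*} [MeasurableSpace α] {μ : Measure α} {p q : ℝ}
    (hpq : p.HolderConjugate q) {W : α → ℝ} (hWm : AEMeasurable W μ) (hW : ∀ᵐ z ∂μ, 0 < W z)
    {g F : α → ℂ} (hg : AEStronglyMeasurable g μ) (hF : AEStronglyMeasurable F μ) :
    ∫⁻ z, ‖F z‖ₑ * ‖g z‖ₑ ∂μ ≤
      eLpNorm g (ENNReal.ofReal p) (μ.withDensity fun z => ENNReal.ofReal (W z)) *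
      (∫⁻ z, ENNReal.ofReal (‖F z‖ ^ q * W z ^ (1 - q)) ∂μ) ^ (1 / q) := by
  have hp := hpq.pos
  have hq := hpq.symm.pos
  rw [eLpNorm_withDensity_eq hp hWm hg]
  have h1 : AEMeasurable (fun z => ENNReal.ofReal (‖g z‖ * W z ^ (1 / p))) μ :=
    (hg.norm.aemeasurable.mul (hWm.pow_const _)).ennreal_ofReal
  have h2 : AEMeasurable (fun z => ENNReal.ofReal (‖F z‖ * W z ^ (-(1 / p)))) μ :=
    (hF.norm.aemeasurable.mul (hWm.pow_const _)).ennreal_ofReal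
  have h := ENNReal.lintegral_mul_le_Lp_mul_Lq μ hpq h1 h2
  refine (le_of_eq ?_).trans (h.trans (le_of_eq ?_))
  · refine lintegral_congr_ae ?_
    filter_upwards [hW] with z hz
    rw [Pi.mul_apply, ← ENNReal.ofReal_mul (by positivity), ← ofReal_norm,
      ← ofReal_norm, ← ENNReal.ofReal_mul (by positivity)]
    congr 1
    rw [Real.rpow_neg hz.le]
    have := (Real.rpow_pos_of_pos hz (1 / p)).ne'
    field_simp
  · congr 2
    · refine lintegral_congr_ae ?_
      filter_upwards [hW] with z hz
      rw [ENNReal.ofReal_rpow_of_nonneg (by positivity) hp.le,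
        Real.mul_rpow (by positivity) (by positivity), ← Real.rpow_mul hz.le,
        one_div_mul_cancel hp.ne', Real.rpow_one]
    · refine lintegral_congr_ae ?_
      filter_upwards [hW] with z hz
      rw [ENNReal.ofReal_rpow_of_nonneg (by positivity) hq.le,
        Real.mul_rpow (by positivity) (by positivity), ← Real.rpow_mul hz.le]
      congr 3
      have := hpq.inv_add_inv_eq_one
      field_simp at this ⊢
      linarith

/-- `horth` says that the projection of `F` is `c H`. By self-adjointness `c ⟨H, f⟩ = ⟨F, Pf⟩`, to
which weighted Hölder and the assumed bound apply. -/
lemma pairing_bound {n : ℕ} {Ω : Set (Fin n → ℂ)} {p q : ℝ} (hpq : p.HolderConjugate q)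
    {W : (Fin n → ℂ) → ℝ} (hWm : AEMeasurable W (volume.restrict Ω))
    (hW : ∀ᵐ z ∂(volume.restrict Ω), 0 < W z) {f F H : (Fin n → ℂ) → ℂ} {c : ℝ} (hc : 0 ≤ c) {C : ℝ≥0}
    (hf : MemLp f 2 (volume.restrict Ω)) (hF : MemLp F 2 (volume.restrict Ω))
    (hHd : DifferentiableOn ℂ H Ω) (hH : MemLp H 2 (volume.restrict Ω))
    (horth : ∀ u : (Fin n → ℂ) → ℂ, DifferentiableOn ℂ u Ω → MemLp u 2 (volume.restrict Ω) →
      ∫ z in Ω, conj (F z) * u z = c * ∫ z in Ω, conj (H z) * u z)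
    (hC : eLpNorm (bergmanProj Ω (hf.toLp f)) (ENNReal.ofReal p)
        ((volume.restrict Ω).withDensity fun z => ENNReal.ofReal (W z)) ≤
      C * eLpNorm f (ENNReal.ofReal p)
        ((volume.restrict Ω).withDensity fun z => ENNReal.ofReal (W z))) :
    ENNReal.ofReal (c * ‖∫ z in Ω, conj (H z) * f z‖) ≤
      C * eLpNorm f (ENNReal.ofReal p)
        ((volume.restrict Ω).withDensity fun z => ENNReal.ofReal (W z)) *
      (∫⁻ z in Ω, ENNReal.ofReal (‖F z‖ ^ q * W z ^ (1 - q))) ^ (1 / q) := by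
  have hinner : ∀ {g : (Fin n → ℂ) → ℂ} (hg : MemLp g 2 (volume.restrict Ω))
      {v : Lp ℂ 2 (volume.restrict Ω)} {u : (Fin n → ℂ) → ℂ}, v =ᵐ[volume.restrict Ω] u →
      inner ℂ (hg.toLp g) v = ∫ z in Ω, conj (g z) * u z := by
    intro g hg v u hvu
    rw [L2.inner_def]
    refine integral_congr_ae ?_
    filter_upwards [hg.coeFn_toLp, hvu] with z h1 h2
    rw [h1, h2, RCLike.inner_apply, mul_comm]
  have hproj : bergmanProj Ω (hF.toLp F) = (c : ℂ) • hH.toLp H := by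
    refine Submodule.eq_starProjection_of_mem_orthogonal ?_ ?_
    · exact Submodule.le_topologicalClosure _
        (Submodule.smul_mem _ _ ⟨H, hHd, hH.coeFn_toLp⟩)
    · rw [Submodule.orthogonal_closure, Submodule.mem_orthogonal']
      rintro v ⟨u, hud, hvu⟩
      have hu : MemLp u 2 (volume.restrict Ω) := (memLp_congr_ae hvu).1 (Lp.memLp v)
      rw [inner_sub_left, inner_smul_left, hinner hF hvu, hinner hH hvu, horth u hud hu,
        Complex.conj_ofReal, sub_self]
  set Pf := bergmanProj Ω (hf.toLp f) with hPf
  have e1 : (c : ℂ) * ∫ z in Ω, conj (H z) * f z = ∫ z in Ω, conj (F z) * Pf z := by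
    rw [← hinner hF (Filter.EventuallyEq.refl _ _), hPf]
    have : inner ℂ (hF.toLp F) (bergmanProj Ω (hf.toLp f)) =
        inner ℂ (bergmanProj Ω (hF.toLp F)) (hf.toLp f) :=
      (Submodule.inner_starProjection_left_eq_right _ _ _).symm
    rw [this, hproj, inner_smul_left, Complex.conj_ofReal, hinner hH hf.coeFn_toLp]
  have e2 : ENNReal.ofReal (c * ‖∫ z in Ω, conj (H z) * f z‖) =
      ‖∫ z in Ω, conj (F z) * Pf z‖ₑ := by
    rw [← e1, ← ofReal_norm, norm_mul, Complex.norm_real, Real.norm_eq_abs,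
      abs_of_nonneg hc]
  rw [e2]
  refine (enorm_integral_le_lintegral_enorm _).trans ?_
  have e3 : ∀ z, ‖conj (F z) * Pf z‖ₑ = ‖F z‖ₑ * ‖Pf z‖ₑ := by
    intro z
    rw [enorm_mul, ← ofReal_norm, RCLike.norm_conj, ofReal_norm]
  simp_rw [e3]
  refine (lintegral_mul_le_weighted hpq hWm hW (Lp.memLp Pf).1 hF.1).trans ?_
  gcongr

/-- Division by `M^(1/p)`, legitimate only for finite nonzero `M`, leaves `M^(1/q)`. -/
lemma le_mul_of_mul_le_rpow {p q : ℝ} (hpq : p.HolderConjugate q) {c : ℝ} (hc : 0 < c) {C : ℝ≥0}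
    {M E : ℝ≥0∞} (hM : M ≠ ⊤)
    (h : ENNReal.ofReal c * M ≤ C * M ^ (1 / p) * E ^ (1 / q)) :
    M ≤ ((C / c.toNNReal) ^ q : ℝ≥0) * E := by
  have hp := hpq.pos
  have hq := hpq.symm.pos
  rcases eq_or_ne M 0 with rfl | hM0
  · simp
  have hMp0 : M ^ (1 / p) ≠ 0 := by simp [ENNReal.rpow_eq_zero_iff, hM0, hM]
  have hMpt : M ^ (1 / p) ≠ ⊤ := ENNReal.rpow_ne_top_of_nonneg (by positivity) hM
  have e : M = M ^ (1 / p) * M ^ (1 / q) := by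
    rw [← ENNReal.rpow_add _ _ hM0 hM, one_div, one_div, hpq.inv_add_inv_eq_one, ENNReal.rpow_one]
  have h1 : ENNReal.ofReal c * M ^ (1 / q) ≤ C * E ^ (1 / q) := by
    rw [← ENNReal.mul_le_mul_iff_right hMp0 hMpt]
    calc M ^ (1 / p) * (ENNReal.ofReal c * M ^ (1 / q))
        = ENNReal.ofReal c * (M ^ (1 / p) * M ^ (1 / q)) := by ring
      _ = ENNReal.ofReal c * M := by rw [← e]
      _ ≤ _ := h
      _ = _ := by ring
  have hc0 : ENNReal.ofReal c ≠ 0 := by simpa using hc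
  have h2 : M ^ (1 / q) ≤ ((C / c.toNNReal : ℝ≥0) : ℝ≥0∞) * E ^ (1 / q) := by
    rw [ENNReal.coe_div (by simpa using hc), ← ENNReal.mul_le_mul_iff_right hc0 ENNReal.ofReal_ne_top]
    refine h1.trans (le_of_eq ?_)
    rw [← mul_assoc]
    congr 1
    exact (ENNReal.mul_div_cancel hc0 ENNReal.ofReal_ne_top).symm
  have h3 := ENNReal.rpow_le_rpow h2 hq.le
  rw [ENNReal.mul_rpow_of_nonneg _ _ hq.le, ← ENNReal.rpow_mul, ← ENNReal.rpow_mul,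
    one_div_mul_cancel hq.ne', ENNReal.rpow_one, ENNReal.rpow_one] at h3
  rwa [ENNReal.coe_rpow_of_nonneg _ hq.le]

/-- Common frame for both domains. The factor `r` is 1 on the polydisc and `1/n!` on the symmetrized
polydisc; it cancels. -/
lemma not_bergmanBoundedOn_of_test_functions {m : ℕ} {Ω : Set (Fin (m + 1) → ℂ)} {p q : ℝ}
    (hpq : p.HolderConjugate q) {W : (Fin (m + 1) → ℂ) → ℝ}
    (hWm : AEMeasurable W (volume.restrict Ω)) (hW : ∀ᵐ z ∂(volume.restrict Ω), 0 < W z)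
    {X : Set ((Fin (m + 1) → ℂ) → ℂ)} {r : ℝ≥0∞} (hr0 : r ≠ 0) (hrt : r ≠ ⊤) {c : ℝ} (hc : 0 < c)
    (hdata : ∀ a : ℝ, 0 < a → a < 1 → ∃ f ∈ X, ∃ F H : (Fin (m + 1) → ℂ) → ℂ,
      MemLp f 2 (volume.restrict Ω) ∧ MemLp F 2 (volume.restrict Ω) ∧
      MemLp H 2 (volume.restrict Ω) ∧ DifferentiableOn ℂ H Ω ∧
      (∀ u : (Fin (m + 1) → ℂ) → ℂ, DifferentiableOn ℂ u Ω → MemLp u 2 (volume.restrict Ω) →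
        ∫ z in Ω, conj (F z) * u z = c * ∫ z in Ω, conj (H z) * u z) ∧
      ∫⁻ z in Ω, ENNReal.ofReal (‖f z‖ ^ p * W z) =
        r * ∫⁻ z in polydisc (m + 1), ENNReal.ofReal (testDensity a z) ∧
      ∫⁻ z in Ω, ENNReal.ofReal (‖F z‖ ^ q * W z ^ (1 - q)) =
        r * ∫⁻ z in mobPolydisc (m + 1) a, ENNReal.ofReal (testDensity a z) ∧
      ∫⁻ z in polydisc (m + 1), ENNReal.ofReal (testDensity a z) ≠ ⊤ ∧
      ENNReal.ofReal ‖∫ z in Ω, conj (H z) * f z‖ =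
        r * ∫⁻ z in polydisc (m + 1), ENNReal.ofReal (testDensity a z)) :
    ¬ BergmanBoundedOn Ω (ENNReal.ofReal p)
      ((volume.restrict Ω).withDensity fun z => ENNReal.ofReal (W z)) X := by
  rintro ⟨C, hC⟩
  -- `a` may be chosen after `C` because `c` does not depend on it.
  obtain ⟨a, ha0, ha1, hlt⟩ := exists_mul_lintegral_mobPolydisc_lt m ((C / c.toNNReal) ^ q)
  obtain ⟨f, hfX, F, H, hf, hF, hH, hHd, horth, hfp, hFq, hM, hpair⟩ := hdata a ha0 ha1
  have h := pairing_bound hpq hWm hW hc.le hf hF hHd hH horth (hC f hfX hf)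
  rw [eLpNorm_withDensity_eq hpq.pos hWm hf.1, hfp, hFq, ENNReal.ofReal_mul hc.le, hpair] at h
  have h2 := le_mul_of_mul_le_rpow hpq hc (ENNReal.mul_ne_top hrt hM) h
  rw [mul_left_comm, ENNReal.mul_le_mul_iff_right hr0 hrt] at h2
  exact absurd hlt (not_lt.2 h2)

end Duality

/-! ### The test functions and their pairing. -/

section TestFunctions

open ComplexConjugate Set

/-- Coincidence of two real parts defines a proper real subspace, hence a null set. Real parts,
rather than the coordinates themselves, are used so that almost every tuple can be sorted. -/
lemma ae_injective_re (n : ℕ) : ∀ᵐ z : Fin n → ℂ, Function.Injective fun i => (z i).re := by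
  have h : ∀ i j : Fin n, ∀ᵐ z : Fin n → ℂ, i ≠ j → (z i).re ≠ (z j).re := by
    intro i j
    by_cases hij : i = j
    · simp [hij]
    · let S : Submodule ℝ (Fin n → ℂ) := LinearMap.ker
        (Complex.reLm ∘ₗ ((LinearMap.proj i : (Fin n → ℂ) →ₗ[ℝ] ℂ) - LinearMap.proj j))
      have hS : S ≠ ⊤ := by
        intro hT
        have : (Pi.single i 1 : Fin n → ℂ) ∈ S := by rw [hT]; trivial
        simp [S, Ne.symm hij] at this
      have h0 := Measure.addHaar_submodule (volume : Measure (Fin n → ℂ)) S hS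
      filter_upwards [measure_eq_zero_iff_ae_notMem.1 h0] with z hz _ he
      apply hz
      simp [S, he]
  filter_upwards [ae_all_iff.2 fun i => ae_all_iff.2 (h i)] with z hz i j hij
  by_contra hne
  exact hz i j hne hij

lemma ae_injective (n : ℕ) : ∀ᵐ z : Fin n → ℂ, Function.Injective z := by
  filter_upwards [ae_injective_re n] with z hz i j hij
  exact hz (congrArg Complex.re hij)

/-- The closed unit polydisc. -/
def closedPolydisc (n : ℕ) : Set (Fin n → ℂ) := Set.pi univ fun _ => Metric.closedBall 0 1

lemma polydisc_subset_closedPolydisc (n : ℕ) : polydisc n ⊆ closedPolydisc n := fun z hz i _ => by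
  simpa using (hz i).le

lemma isCompact_closedPolydisc (n : ℕ) : IsCompact (closedPolydisc n) :=
  isCompact_univ_pi fun _ => isCompact_closedBall 0 1

lemma memLp_of_continuousOn_closedPolydisc {n : ℕ} {g : (Fin n → ℂ) → ℂ}
    (hg : ContinuousOn g (closedPolydisc n)) (p : ℝ≥0∞) :
    MemLp g p (volume.restrict (polydisc n)) := by
  obtain ⟨C, hC⟩ := (isCompact_closedPolydisc n).exists_bound_of_continuousOn hg
  have hD := (isOpen_polydisc n).measurableSet
  refine MemLp.of_bound ((hg.mono (polydisc_subset_closedPolydisc n)).aestronglyMeasurable hD) C ?_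
  exact (ae_restrict_iff' hD).2 (Filter.Eventually.of_forall fun z hz =>
    hC z (polydisc_subset_closedPolydisc n hz))

variable {a : ℝ}

lemma den_ne_zero_of_mem_closedPolydisc (ha0 : 0 < a) (ha1 : a < 1) {n : ℕ} {z : Fin n → ℂ}
    (hz : z ∈ closedPolydisc n) : den a z ≠ 0 := by
  refine Finset.prod_ne_zero_iff.2 fun i _ h => ?_
  have h1 : (a : ℂ) * z i = 1 := by linear_combination -h
  have h2 := congrArg norm h1
  rw [norm_mul, Complex.norm_real, Real.norm_eq_abs, abs_of_pos ha0, norm_one] at h2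
  have h3 : ‖z i‖ ≤ 1 := by simpa using hz i trivial
  nlinarith

lemma continuous_den (n : ℕ) (a : ℝ) : Continuous (den (n := n) a) := by
  unfold den; fun_prop

lemma differentiable_den (n : ℕ) (a : ℝ) : Differentiable ℂ (den (n := n) a) := by
  unfold den; fun_prop

/-- The antisymmetric function on which the weighted `Lᵖ` bound fails. -/
noncomputable def testFun {n : ℕ} (a : ℝ) (z : Fin n → ℂ) : ℂ :=
  vand z * (conj (den a z) * (den a z ^ n)⁻¹)

lemma continuousOn_testFun (ha0 : 0 < a) (ha1 : a < 1) (n : ℕ) :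
    ContinuousOn (testFun (n := n) a) (closedPolydisc n) := by
  unfold testFun
  refine continuous_vand.continuousOn.mul (ContinuousOn.mul ?_ (ContinuousOn.inv₀ ?_ ?_))
  · exact (Complex.continuous_conj.comp (continuous_den n a)).continuousOn
  · exact ((continuous_den n a).pow n).continuousOn
  · exact fun z hz => pow_ne_zero n (den_ne_zero_of_mem_closedPolydisc ha0 ha1 hz)

lemma continuousOn_antiKernel (ha0 : 0 < a) (ha1 : a < 1) (n : ℕ) :
    ContinuousOn (antiKernel (n := n) a) (closedPolydisc n) := by
  unfold antiKernel
  refine continuous_vand.continuousOn.mul (ContinuousOn.inv₀ ?_ ?_)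
  · exact ((continuous_den n a).pow (n + 1)).continuousOn
  · exact fun z hz => pow_ne_zero _ (den_ne_zero_of_mem_closedPolydisc ha0 ha1 hz)

lemma differentiableOn_antiKernel (ha0 : 0 < a) (ha1 : a < 1) (n : ℕ) :
    DifferentiableOn ℂ (antiKernel (n := n) a) (polydisc n) := by
  unfold antiKernel
  refine differentiable_vand.differentiableOn.mul (DifferentiableOn.inv ?_ ?_)
  · exact ((differentiable_den n a).pow (n + 1)).differentiableOn
  · exact fun z hz => pow_ne_zero _ (den_ne_zero ha0 ha1 hz)

/-- The factor `conj (den a z)` in `testFun` is there to make this product nonnegative, so that no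
cancellation occurs in the pairing. -/
lemma conj_antiKernel_mul_testFun (ha0 : 0 < a) (ha1 : a < 1) {n : ℕ} {z : Fin n → ℂ}
    (hz : z ∈ polydisc n) : conj (antiKernel a z) * testFun a z = (testDensity a z : ℂ) := by
  have hd := den_ne_zero ha0 ha1 hz
  have hd' : conj (den a z) ≠ 0 := (map_ne_zero _).2 hd
  have h1 : ∀ w : ℂ, (‖w‖ : ℂ) ^ 2 = w * conj w := fun w => by
    rw [← Complex.ofReal_pow, ← Complex.normSq_eq_norm_sq, ← Complex.mul_conj]
  rw [testDensity, pow_mul]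
  push_cast
  rw [h1, h1, antiKernel, testFun, mul_pow, map_mul, map_inv₀, map_pow, pow_succ]
  field_simp

lemma lintegral_testDensity_ne_top (ha0 : 0 < a) (ha1 : a < 1) (n : ℕ) :
    Integrable (testDensity (n := n) a) (volume.restrict (polydisc n)) ∧
    ∫⁻ z in polydisc n, ENNReal.ofReal (testDensity a z) ≠ ⊤ := by
  have hc : ContinuousOn (testDensity (n := n) a) (closedPolydisc n) := by
    unfold testDensity
    refine ((continuous_vand.norm).pow 2).continuousOn.mul (ContinuousOn.inv₀ ?_ ?_)
    · exact ((continuous_den n a).norm.pow _).continuousOn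
    · exact fun z hz => pow_ne_zero _ (norm_ne_zero_iff.2
        (den_ne_zero_of_mem_closedPolydisc ha0 ha1 hz))
  have hI : Integrable (testDensity (n := n) a) (volume.restrict (polydisc n)) :=
    (hc.integrableOn_compact (isCompact_closedPolydisc n)).mono_set
      (polydisc_subset_closedPolydisc n)
  exact ⟨hI, hI.lintegral_lt_top.ne⟩

lemma enorm_integral_conj_antiKernel_mul_testFun (ha0 : 0 < a) (ha1 : a < 1) (n : ℕ) :
    ENNReal.ofReal ‖∫ z in polydisc n, conj (antiKernel a z) * testFun a z‖ =
      ∫⁻ z in polydisc n, ENNReal.ofReal (testDensity a z) := by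
  rw [setIntegral_congr_fun (isOpen_polydisc n).measurableSet
    fun z hz => conj_antiKernel_mul_testFun ha0 ha1 hz, integral_complex_ofReal, Complex.norm_real,
    Real.norm_eq_abs, abs_of_nonneg (integral_nonneg fun z => testDensity_nonneg a z),
    ofReal_integral_eq_lintegral_ofReal (lintegral_testDensity_ne_top ha0 ha1 n).1
    (Filter.Eventually.of_forall fun z => testDensity_nonneg a z)]

end TestFunctions

/-! ### Unboundedness on the weighted antisymmetric space. -/

section WeightedPolydisc

open ComplexConjugate Set

/-- The dual exponent of `2n/(n-1)`, with `n = m + 1`. -/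
lemma holderConjugate_exponents {m : ℕ} (hm : 1 ≤ m) {p : ℝ} (hp : p = 2 * ((m : ℝ) + 1) / m) :
    p.HolderConjugate (2 * ((m : ℝ) + 1) / (m + 2)) := by
  have hm0 : (0 : ℝ) < m := by exact_mod_cast hm
  rw [Real.holderConjugate_iff]
  subst hp
  constructor
  · rw [lt_div_iff₀ hm0]; linarith
  · field_simp; ring

/-- This is where the critical exponent enters: `(n-1) p = 2n` with `n = m + 1`. -/
lemma testFun_rpow {m : ℕ} {p : ℝ} (hmp : m * p = 2 * ((m : ℝ) + 1)) {V D : ℝ} (hV : 0 < V)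
    (hD : 0 < D) :
    (V * (D * (D ^ (m + 1))⁻¹)) ^ p * V ^ (2 - p) = V ^ 2 * (D ^ (2 * (m + 1)))⁻¹ := by
  have e : D * (D ^ (m + 1))⁻¹ = D ^ (-(m : ℝ)) := by
    rw [Real.rpow_neg hD.le, Real.rpow_natCast, pow_succ]
    field_simp
  rw [e, Real.mul_rpow hV.le (by positivity), ← Real.rpow_mul hD.le, mul_right_comm,
    ← Real.rpow_add hV]
  congr 1
  · rw [show p + (2 - p) = ((2 : ℕ) : ℝ) by push_cast; ring, Real.rpow_natCast]
  · rw [← Real.rpow_natCast, ← Real.rpow_neg hD.le]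
    congr 1
    push_cast; linarith

/-- The dual count: `(n+1) q = 2n` for `D`, and `q + (2-p)(1-q) = 2`, from `pq = p + q`, for `V`. -/
lemma antiKernel_rpow {m : ℕ} {p q : ℝ} (hpq : p.HolderConjugate q)
    (hmq : ((m : ℝ) + 2) * q = 2 * ((m : ℝ) + 1)) {V D : ℝ} (hV : 0 < V)
    (hD : 0 < D) :
    (V * (D ^ (m + 1 + 1))⁻¹) ^ q * (V ^ (2 - p)) ^ (1 - q) = V ^ 2 * (D ^ (2 * (m + 1)))⁻¹ := by
  have e : (D ^ (m + 1 + 1))⁻¹ = D ^ (-((m : ℝ) + 2)) := by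
    rw [Real.rpow_neg hD.le, ← Real.rpow_natCast]
    congr 2; push_cast; ring
  rw [e, Real.mul_rpow hV.le (by positivity), ← Real.rpow_mul hD.le, ← Real.rpow_mul hV.le,
    mul_right_comm, ← Real.rpow_add hV]
  congr 1
  · rw [← Real.rpow_natCast]
    congr 1
    have := hpq.mul_eq_add
    push_cast; linarith
  · rw [← Real.rpow_natCast, ← Real.rpow_neg hD.le]
    congr 1
    push_cast; linarith

lemma isAntisymmFun_testFun (n : ℕ) (a : ℝ) : IsAntisymmFun (testFun (n := n) a) := by
  intro j k hjk
  refine Filter.Eventually.of_forall fun z => ?_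
  have hd : den a (fun i => z (Equiv.swap j k i)) = den a z :=
    Equiv.prod_comp (Equiv.swap j k) fun i => 1 - (a : ℂ) * z i
  rw [testFun, testFun, hd, vand_comp_perm, Equiv.Perm.sign_swap hjk]
  simp

lemma norm_testFun {n : ℕ} (a : ℝ) (z : Fin n → ℂ) :
    ‖testFun a z‖ = ‖vand z‖ * (‖den a z‖ * (‖den a z‖ ^ n)⁻¹) := by
  rw [testFun, norm_mul, norm_mul, RCLike.norm_conj, norm_inv, norm_pow]

lemma norm_antiKernel {n : ℕ} (a : ℝ) (z : Fin n → ℂ) :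
    ‖antiKernel a z‖ = ‖vand z‖ * (‖den a z‖ ^ (n + 1))⁻¹ := by
  rw [antiKernel, norm_mul, norm_inv, norm_pow]

lemma setLIntegral_indicator_rpow {n : ℕ} {Ω E : Set (Fin n → ℂ)} (hE : MeasurableSet E)
    (hEΩ : E ⊆ Ω) (H : (Fin n → ℂ) → ℂ) (w : (Fin n → ℂ) → ℝ) {q : ℝ} (hq : 0 < q) :
    ∫⁻ z in Ω, ENNReal.ofReal (‖E.indicator H z‖ ^ q * w z) =
      ∫⁻ z in E, ENNReal.ofReal (‖H z‖ ^ q * w z) := by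
  have h : ∀ z, ENNReal.ofReal (‖E.indicator H z‖ ^ q * w z) =
      E.indicator (fun z => ENNReal.ofReal (‖H z‖ ^ q * w z)) z := by
    intro z
    by_cases hz : z ∈ E
    · rw [indicator_of_mem hz, indicator_of_mem hz]
    · rw [indicator_of_notMem hz, indicator_of_notMem hz, norm_zero, Real.zero_rpow hq.ne',
        zero_mul, ENNReal.ofReal_zero]
  simp_rw [h]
  rw [setLIntegral_indicator hE, inter_eq_left.2 hEΩ]

lemma setIntegral_conj_indicator_mul {n : ℕ} {Ω E : Set (Fin n → ℂ)} (hE : MeasurableSet E)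
    (hEΩ : E ⊆ Ω) (H u : (Fin n → ℂ) → ℂ) :
    ∫ z in Ω, conj (E.indicator H z) * u z = ∫ z in E, conj (H z) * u z := by
  have h : ∀ z, conj (E.indicator H z) * u z = E.indicator (fun z => conj (H z) * u z) z := by
    intro z
    by_cases hz : z ∈ E
    · rw [indicator_of_mem hz, indicator_of_mem hz]
    · rw [indicator_of_notMem hz, indicator_of_notMem hz, map_zero, zero_mul]
  simp_rw [h]
  rw [setIntegral_indicator hE, inter_eq_right.2 hEΩ]

theorem not_bergmanBoundedOn_polydisc {m : ℕ} (hm : 1 ≤ m) {p : ℝ}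
    (hp : p = 2 * ((m : ℝ) + 1) / m) :
    ¬ BergmanBoundedOn (polydisc (m + 1)) (ENNReal.ofReal p) (weightedMeasure (m + 1) p)
      (LpAnti (m + 1) p) := by
  have hm0 : (0 : ℝ) < m := by exact_mod_cast hm
  have hpq := holderConjugate_exponents hm hp
  set q : ℝ := 2 * ((m : ℝ) + 1) / (m + 2) with hq
  have hmp : m * p = 2 * ((m : ℝ) + 1) := by rw [hp]; field_simp
  have hmq : ((m : ℝ) + 2) * q = 2 * ((m : ℝ) + 1) := by rw [hq]; field_simp
  have hD := (isOpen_polydisc (m + 1)).measurableSet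
  -- The weight is given by the Jacobian, which has been identified with `vand` only at tuples with
  -- distinct entries; these have full measure.
  have hWV : ∀ᵐ z ∂(volume.restrict (polydisc (m + 1))), 0 < ‖vand z‖ ∧
      ‖symmJacobian (m + 1) z‖ ^ (2 - p) = ‖vand z‖ ^ (2 - p) := by
    refine ae_restrict_of_ae ?_
    filter_upwards [ae_injective (m + 1)] with z hz
    rw [norm_symmJacobian hz]
    exact ⟨norm_pos_iff.2 ((vand_ne_zero_iff z).2 hz), rfl⟩
  have hWm : AEMeasurable (fun z => ‖symmJacobian (m + 1) z‖ ^ (2 - p))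
      (volume.restrict (polydisc (m + 1))) := by
    refine AEMeasurable.congr (f := fun z => ‖vand z‖ ^ (2 - p)) ?_ ?_
    · exact (continuous_vand.norm.measurable.pow_const _).aemeasurable
    · filter_upwards [hWV] with z hz using hz.2.symm
  have hW : ∀ᵐ z ∂(volume.restrict (polydisc (m + 1))),
      0 < ‖symmJacobian (m + 1) z‖ ^ (2 - p) := by
    filter_upwards [hWV] with z hz
    rw [hz.2]
    exact Real.rpow_pos_of_pos hz.1 _
  refine not_bergmanBoundedOn_of_test_functions hpq hWm hW one_ne_zero ENNReal.one_ne_top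
    (projFactor_pos (m + 1)) fun a ha0 ha1 => ?_
  have hE := (isCompact_mobPolydisc (m + 1) ha0 ha1).isClosed.measurableSet
  have hsub := mobPolydisc_subset (m + 1) ha0 ha1
  have hft := (lintegral_testDensity_ne_top ha0 ha1 (m + 1)).2
  have hfp : ∫⁻ z in polydisc (m + 1), ENNReal.ofReal (‖testFun a z‖ ^ p *
      ‖symmJacobian (m + 1) z‖ ^ (2 - p)) =
      ∫⁻ z in polydisc (m + 1), ENNReal.ofReal (testDensity a z) := by
    refine lintegral_congr_ae ?_
    filter_upwards [hWV, ae_restrict_mem hD] with z hz hzD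
    rw [hz.2, norm_testFun, testFun_rpow hmp hz.1 (norm_pos_iff.2 (den_ne_zero ha0 ha1 hzD)),
      testDensity]
  have hf2 : ∀ r : ℝ≥0∞, MemLp (testFun a) r (volume.restrict (polydisc (m + 1))) :=
    memLp_of_continuousOn_closedPolydisc (continuousOn_testFun ha0 ha1 (m + 1))
  have hH2 : MemLp (antiKernel a) 2 (volume.restrict (polydisc (m + 1))) :=
    memLp_of_continuousOn_closedPolydisc (continuousOn_antiKernel ha0 ha1 (m + 1)) 2
  refine ⟨testFun a, ⟨⟨?_, ?_⟩, isAntisymmFun_testFun (m + 1) a⟩,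
    (mobPolydisc (m + 1) a).indicator (antiKernel a), antiKernel a, hf2 2, hH2.indicator hE, hH2,
    differentiableOn_antiKernel ha0 ha1 (m + 1), ?_, ?_, ?_, hft, ?_⟩
  · exact (hf2 2).1.mono_ac (withDensity_absolutelyContinuous _ _)
  · rw [weightedMeasure, eLpNorm_withDensity_eq hpq.pos hWm (hf2 2).1, hfp]
    exact ENNReal.rpow_lt_top_of_nonneg (by have := hpq.pos; positivity) hft
  · intro u hud hu
    rw [setIntegral_conj_indicator_mul hE hsub, integral_mobPolydisc_antiKernel ha0 ha1 hud hu]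
  · rw [hfp, one_mul]
  · rw [setLIntegral_indicator_rpow hE hsub (antiKernel a) _ hpq.symm.pos, one_mul]
    refine lintegral_congr_ae ?_
    filter_upwards [ae_mono (Measure.restrict_mono_set _ hsub) hWV, ae_restrict_mem hE] with z hz hzE
    rw [hz.2, norm_antiKernel, antiKernel_rpow hpq hmq hz.1
      (norm_pos_iff.2 (den_ne_zero ha0 ha1 (hsub hzE))), testDensity]
  · rw [one_mul, enorm_integral_conj_antiKernel_mul_testFun ha0 ha1]

end WeightedPolydisc

/-! ### Integration under the symmetrization map. -/

section ChangeOfVariables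

open ComplexConjugate Set

/-- The tuples in the polydisc whose real parts are strictly increasing: a fundamental domain for
the permutation of the coordinates, on which the symmetrization map is injective. -/
def orderedPolydisc (n : ℕ) : Set (Fin n → ℂ) :=
  {z | z ∈ polydisc n ∧ StrictMono fun i => (z i).re}

lemma orderedPolydisc_subset (n : ℕ) : orderedPolydisc n ⊆ polydisc n := fun _ h => h.1

lemma measurableSet_orderedPolydisc (n : ℕ) : MeasurableSet (orderedPolydisc n) := by
  refine (isOpen_polydisc n).measurableSet.inter (s₂ := {z | StrictMono fun i => (z i).re}) ?_
  have : {z : Fin n → ℂ | StrictMono fun i => (z i).re} =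
      ⋂ i, ⋂ j, {z | i < j → (z i).re < (z j).re} := by
    ext z
    simp [StrictMono]
  rw [this]
  refine MeasurableSet.iInter fun i => MeasurableSet.iInter fun j => ?_
  by_cases hij : i < j
  · simp only [hij, true_imp_iff]
    exact measurableSet_lt (by fun_prop) (by fun_prop)
  · simp [hij]

lemma injective_of_mem_orderedPolydisc {n : ℕ} {z : Fin n → ℂ} (hz : z ∈ orderedPolydisc n) :
    Function.Injective z := fun _ _ h => hz.2.injective (congrArg Complex.re h)

/-- The fibre determines the set of coordinates, and strictly increasing real parts leave only one
way to list it. -/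
lemma injOn_symmMap_orderedPolydisc (n : ℕ) : InjOn (symmMap n) (orderedPolydisc n) := by
  intro z hz w hw h
  have hr := range_eq_of_symmMap_eq h
  have hre : (fun i => (z i).re) = fun i => (w i).re := by
    refine (StrictMono.range_inj hz.2 hw.2).1 ?_
    have := congrArg (image Complex.re) hr
    rwa [← range_comp, ← range_comp] at this
  funext i
  obtain ⟨j, hj⟩ : z i ∈ range w := hr ▸ mem_range_self i
  have h1 : (w j).re = (w i).re := by rw [hj]; exact congrFun hre i
  rw [← hj, hw.2.injective h1]

lemma exists_perm_strictMono {n : ℕ} {x : Fin n → ℝ} (hx : Function.Injective x) :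
    ∃ σ : Equiv.Perm (Fin n), StrictMono fun i => x (σ i) :=
  ⟨Tuple.sort x, (Tuple.monotone_sort x).strictMono_of_injective (hx.comp (Tuple.sort x).injective)⟩

lemma comp_perm_mem_polydisc {n : ℕ} {z : Fin n → ℂ} (σ : Equiv.Perm (Fin n)) :
    (fun i => z (σ i)) ∈ polydisc n ↔ z ∈ polydisc n :=
  ⟨fun h i => by simpa using h (σ.symm i), fun h i => h (σ i)⟩

/-- Tuples with distinct real parts can be sorted without changing the image; the others form a null
set, and a differentiable map sends it to a null set. -/
lemma symmPolydisc_ae_eq (n : ℕ) :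
    symmMap n '' orderedPolydisc n =ᵐ[volume] symmPolydisc n := by
  have hdiff : symmPolydisc n \ symmMap n '' orderedPolydisc n ⊆
      symmMap n '' {z | ¬ Function.Injective fun i => (z i).re} := by
    rintro _ ⟨⟨z, hz, rfl⟩, hnot⟩
    refine ⟨z, fun hinj => hnot ?_, rfl⟩
    obtain ⟨σ, hσ⟩ := exists_perm_strictMono hinj
    exact ⟨fun i => z (σ i), ⟨(comp_perm_mem_polydisc σ).2 hz, hσ⟩, symmMap_comp_perm z σ⟩
  have hnull : volume (symmMap n '' {z | ¬ Function.Injective fun i => (z i).re}) = 0 :=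
    addHaar_image_eq_zero_of_differentiableOn_of_addHaar_eq_zero volume
      ((differentiable_symmMap n).restrictScalars ℝ).differentiableOn (ae_iff.1 (ae_injective_re n))
  refine Filter.EventuallyLE.antisymm ?_ ?_
  · exact (image_mono (orderedPolydisc_subset n)).eventuallyLE
  · exact ae_le_set.2 (measure_mono_null hdiff hnull)

lemma hasFDerivWithinAt_symmMap (n : ℕ) (s : Set (Fin n → ℂ)) : ∀ z ∈ s,
    HasFDerivWithinAt (symmMap n) ((fderiv ℂ (symmMap n) z).restrictScalars ℝ) s z := fun z _ =>
  ((differentiable_symmMap n z).hasFDerivAt.restrictScalars ℝ).hasFDerivWithinAt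

lemma abs_det_fderiv_symmMap {n : ℕ} {z : Fin n → ℂ} (hz : z ∈ orderedPolydisc n) :
    |((fderiv ℂ (symmMap n) z).restrictScalars ℝ).det| = ‖vand z‖ ^ 2 := by
  rw [abs_det_restrictScalars, ← norm_symmJacobian (injective_of_mem_orderedPolydisc hz)]
  rfl

lemma nullMeasurableSet_symmPolydisc (n : ℕ) : NullMeasurableSet (symmPolydisc n) :=
  (measurable_image_of_fderivWithin (measurableSet_orderedPolydisc n)
    (hasFDerivWithinAt_symmMap n _)
    (injOn_symmMap_orderedPolydisc n)).nullMeasurableSet.congr (symmPolydisc_ae_eq n)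

/-- The permutation of coordinates by `σ`. -/
noncomputable def permEquiv {n : ℕ} (σ : Equiv.Perm (Fin n)) : (Fin n → ℂ) ≃ᵐ (Fin n → ℂ) :=
  MeasurableEquiv.piCongrLeft (fun _ => ℂ) σ.symm

lemma permEquiv_apply {n : ℕ} (σ : Equiv.Perm (Fin n)) (z : Fin n → ℂ) :
    permEquiv σ z = fun i => z (σ i) := by
  funext i
  have := MeasurableEquiv.piCongrLeft_apply_apply (β := fun _ : Fin n => ℂ) σ.symm z (σ i)
  simpa [permEquiv] using this

lemma measurePreserving_permEquiv {n : ℕ} (σ : Equiv.Perm (Fin n)) :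
    MeasurePreserving (permEquiv σ) volume volume :=
  volume_measurePreserving_piCongrLeft (fun _ => ℂ) σ.symm

lemma pairwise_disjoint_permEquiv_preimage (n : ℕ) :
    Pairwise (Function.onFun Disjoint fun σ : Equiv.Perm (Fin n) =>
      permEquiv σ ⁻¹' orderedPolydisc n) := by
  intro σ τ hστ
  rw [Function.onFun, Set.disjoint_left]
  intro z hz hz'
  rw [mem_preimage, permEquiv_apply] at hz hz'
  apply hστ
  have h := (StrictMono.range_inj hz.2 hz'.2).1 ?_
  · have hinj : Function.Injective fun i => (z i).re := by
      intro i j hij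
      have := hz.2.injective (a₁ := σ.symm i) (a₂ := σ.symm j) (by simpa using hij)
      simpa using this
    ext1 i
    exact hinj (congrFun h i)
  · have : ∀ ρ : Equiv.Perm (Fin n), range (fun i => (z (ρ i)).re) = range fun i => (z i).re :=
      fun ρ => ρ.surjective.range_comp fun i => (z i).re
    rw [this, this]

lemma iUnion_permEquiv_preimage_ae_eq (n : ℕ) :
    (⋃ σ : Equiv.Perm (Fin n), permEquiv σ ⁻¹' orderedPolydisc n) =ᵐ[volume] polydisc n := by
  refine Filter.EventuallyLE.antisymm ?_ ?_
  · refine (iUnion_subset fun σ z hz => ?_ : _ ⊆ polydisc n).eventuallyLE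
    rw [mem_preimage, permEquiv_apply] at hz
    exact (comp_perm_mem_polydisc σ).1 hz.1
  · filter_upwards [ae_injective_re n] with z hinj hz
    obtain ⟨σ, hσ⟩ := exists_perm_strictMono hinj
    refine mem_iUnion.2 ⟨σ, ?_⟩
    rw [mem_preimage, permEquiv_apply]
    exact ⟨(comp_perm_mem_polydisc σ).2 hz, hσ⟩

/-- Up to a null set the polydisc is the disjoint union of the `n!` permuted copies of
`orderedPolydisc`. -/
lemma setLIntegral_polydisc_of_symmetric {n : ℕ} {g : (Fin n → ℂ) → ℝ≥0∞}
    (hg : ∀ (σ : Equiv.Perm (Fin n)) z, g (fun i => z (σ i)) = g z) :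
    ∫⁻ z in polydisc n, g z = (n.factorial : ℝ≥0∞) * ∫⁻ z in orderedPolydisc n, g z := by
  rw [← setLIntegral_congr (iUnion_permEquiv_preimage_ae_eq n), lintegral_iUnion
    (fun σ => (permEquiv σ).measurable (measurableSet_orderedPolydisc n))
    (pairwise_disjoint_permEquiv_preimage n), tsum_fintype]
  have : ∀ σ : Equiv.Perm (Fin n), ∫⁻ z in permEquiv σ ⁻¹' orderedPolydisc n, g z =
      ∫⁻ z in orderedPolydisc n, g z := by
    intro σ
    have h := (measurePreserving_permEquiv σ).setLIntegral_comp_preimage_emb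
      (permEquiv σ).measurableEmbedding g (orderedPolydisc n)
    simp_rw [permEquiv_apply, hg] at h
    exact h
  simp_rw [this]
  rw [Finset.sum_const, Finset.card_univ, Fintype.card_perm, Fintype.card_fin, nsmul_eq_mul]

lemma setIntegral_polydisc_of_symmetric {n : ℕ} {g : (Fin n → ℂ) → ℂ}
    (hg : ∀ (σ : Equiv.Perm (Fin n)) z, g (fun i => z (σ i)) = g z)
    (hgi : IntegrableOn g (polydisc n)) :
    ∫ z in polydisc n, g z = (n.factorial : ℂ) * ∫ z in orderedPolydisc n, g z := by
  have hsub : ∀ σ : Equiv.Perm (Fin n), permEquiv σ ⁻¹' orderedPolydisc n ⊆ polydisc n := by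
    intro σ z hz
    rw [mem_preimage, permEquiv_apply] at hz
    exact (comp_perm_mem_polydisc σ).1 hz.1
  rw [← setIntegral_congr_set (iUnion_permEquiv_preimage_ae_eq n), integral_iUnion_fintype
    (fun σ => (permEquiv σ).measurable (measurableSet_orderedPolydisc n))
    (pairwise_disjoint_permEquiv_preimage n) (fun σ => hgi.mono_set (hsub σ))]
  have : ∀ σ : Equiv.Perm (Fin n), ∫ z in permEquiv σ ⁻¹' orderedPolydisc n, g z =
      ∫ z in orderedPolydisc n, g z := by
    intro σ
    have h := (measurePreserving_permEquiv σ).setIntegral_preimage_emb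
      (permEquiv σ).measurableEmbedding g (orderedPolydisc n)
    simp_rw [permEquiv_apply, hg] at h
    exact h
  simp_rw [this]
  rw [Finset.sum_const, Finset.card_univ, Fintype.card_perm, Fintype.card_fin, nsmul_eq_mul]

/-- Change of variables under the symmetrization map, for nonnegative functions. -/
lemma lintegral_symmMap (n : ℕ) (v : (Fin n → ℂ) → ℝ≥0∞) :
    ∫⁻ z in polydisc n, ENNReal.ofReal (‖vand z‖ ^ 2) * v (symmMap n z) =
      (n.factorial : ℝ≥0∞) * ∫⁻ w in symmPolydisc n, v w := by
  rw [setLIntegral_polydisc_of_symmetric (fun σ z => by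
    rw [symmMap_comp_perm, norm_vand_comp_perm]), ← setLIntegral_congr (symmPolydisc_ae_eq n),
    lintegral_image_eq_lintegral_abs_det_fderiv_mul volume (measurableSet_orderedPolydisc n)
      (hasFDerivWithinAt_symmMap n _) (injOn_symmMap_orderedPolydisc n)]
  congr 1
  refine setLIntegral_congr_fun (measurableSet_orderedPolydisc n) fun z hz => ?_
  simp only [abs_det_fderiv_symmMap hz]

/-- Change of variables under the symmetrization map, for integrable functions. -/
lemma integral_symmMap (n : ℕ) (v : (Fin n → ℂ) → ℂ)
    (hv : IntegrableOn (fun z => ((‖vand z‖ ^ 2 : ℝ) : ℂ) * v (symmMap n z)) (polydisc n)) :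
    ∫ z in polydisc n, ((‖vand z‖ ^ 2 : ℝ) : ℂ) * v (symmMap n z) =
      (n.factorial : ℂ) * ∫ w in symmPolydisc n, v w := by
  rw [setIntegral_polydisc_of_symmetric (fun σ z => by
    rw [symmMap_comp_perm, norm_vand_comp_perm]) hv, ← setIntegral_congr_set (symmPolydisc_ae_eq n),
    integral_image_eq_integral_abs_det_fderiv_smul volume (measurableSet_orderedPolydisc n)
      (hasFDerivWithinAt_symmMap n _) (injOn_symmMap_orderedPolydisc n)]
  congr 1
  refine setIntegral_congr_fun (measurableSet_orderedPolydisc n) fun z hz => ?_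
  simp only [abs_det_fderiv_symmMap hz, Complex.real_smul]

end ChangeOfVariables

/-! ### Transfer to the symmetrized polydisc. -/

section SymmetrizedPolydisc

open ComplexConjugate Set

variable {a : ℝ}

/-- The polynomial `1 - a w_1 + a² w_2 - …`, which pulls back to `∏ (1 - a z_i)`. -/
noncomputable def symmDen {n : ℕ} (a : ℝ) (w : Fin n → ℂ) : ℂ :=
  1 + ∑ i : Fin n, (-(a : ℂ)) ^ ((i : ℕ) + 1) * w i

lemma symmDen_symmMap {n : ℕ} (a : ℝ) (z : Fin n → ℂ) : symmDen a (symmMap n z) = den a z := by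
  have h := prod_add_mul_eq_symmMap z 1 (-(a : ℂ))
  simp only [one_pow, mul_one] at h
  rw [symmDen, ← h, den]
  exact Finset.prod_congr rfl fun i _ => by ring

lemma differentiable_symmDen (n : ℕ) (a : ℝ) : Differentiable ℂ (symmDen (n := n) a) := by
  unfold symmDen; fun_prop

lemma volume_symmPolydisc_lt_top (n : ℕ) : volume (symmPolydisc n) < ⊤ :=
  (measure_mono (image_mono (polydisc_subset_closedPolydisc n))).trans_lt
    ((isCompact_closedPolydisc n).image (differentiable_symmMap n).continuous).measure_lt_top

instance instIsFiniteMeasureSymmPolydisc (n : ℕ) :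
    IsFiniteMeasure (volume.restrict (symmPolydisc n)) :=
  ⟨by simpa using volume_symmPolydisc_lt_top n⟩

lemma memLp_symmPolydisc {n : ℕ} {g : (Fin n → ℂ) → ℂ} (hgm : Measurable g)
    (hg : ContinuousOn (fun z => g (symmMap n z)) (closedPolydisc n)) (p : ℝ≥0∞) :
    MemLp g p (volume.restrict (symmPolydisc n)) := by
  obtain ⟨C, hC⟩ := (isCompact_closedPolydisc n).exists_bound_of_continuousOn hg
  refine MemLp.of_bound hgm.aestronglyMeasurable C ?_
  filter_upwards [ae_restrict_mem₀ (nullMeasurableSet_symmPolydisc n)] with w hw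
  obtain ⟨z, hz, rfl⟩ := hw
  exact hC z (polydisc_subset_closedPolydisc n hz)

/-- The pull-back, multiplied by the Jacobian, of an element of the Bergman space of the
symmetrized polydisc is square-integrable. -/
lemma memLp_vand_mul_comp_symmMap {n : ℕ} {u : (Fin n → ℂ) → ℂ}
    (hud : DifferentiableOn ℂ u (symmPolydisc n))
    (hu : MemLp u 2 (volume.restrict (symmPolydisc n))) :
    DifferentiableOn ℂ (fun z => vand z * u (symmMap n z)) (polydisc n) ∧
    MemLp (fun z => vand z * u (symmMap n z)) 2 (volume.restrict (polydisc n)) := by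
  have hd : DifferentiableOn ℂ (fun z => vand z * u (symmMap n z)) (polydisc n) :=
    differentiable_vand.differentiableOn.mul
      (hud.comp (differentiable_symmMap n).differentiableOn fun z hz => mem_image_of_mem _ hz)
  refine ⟨hd, hd.continuousOn.aestronglyMeasurable (isOpen_polydisc n).measurableSet, ?_⟩
  rw [eLpNorm_lt_top_iff_lintegral_rpow_enorm_lt_top two_ne_zero ENNReal.ofNat_ne_top]
  have h2 := (eLpNorm_lt_top_iff_lintegral_rpow_enorm_lt_top two_ne_zero
    ENNReal.ofNat_ne_top).1 hu.2
  have hcv := lintegral_symmMap n fun w => ‖u w‖ₑ ^ (2 : ℝ≥0∞).toReal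
  have e : ∀ z, ‖vand z * u (symmMap n z)‖ₑ ^ (2 : ℝ≥0∞).toReal =
      ENNReal.ofReal (‖vand z‖ ^ 2) * ‖u (symmMap n z)‖ₑ ^ (2 : ℝ≥0∞).toReal := by
    intro z
    rw [enorm_mul, ENNReal.mul_rpow_of_nonneg _ _ (by simp), ENNReal.toReal_ofNat,
      ENNReal.ofReal_pow (norm_nonneg _), ofReal_norm]
    norm_cast
  simp_rw [e]
  rw [hcv]
  exact ENNReal.mul_lt_top (ENNReal.natCast_lt_top _) h2

/-- Every coordinate satisfies the same condition in `mobPolydisc`, so membership depends only on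
the set of coordinates. Hence truncation to the image pulls back to truncation to `mobPolydisc`. -/
lemma symmMap_mem_image_mobPolydisc {n : ℕ} {z : Fin n → ℂ} :
    symmMap n z ∈ symmMap n '' mobPolydisc n a ↔ z ∈ mobPolydisc n a := by
  refine ⟨?_, fun h => mem_image_of_mem _ h⟩
  rintro ⟨w, hw, hwz⟩ i
  obtain ⟨j, hj⟩ : z i ∈ range w := (range_eq_of_symmMap_eq hwz) ▸ mem_range_self i
  exact hj ▸ hw j

lemma ofReal_norm_setIntegral_symmPolydisc {n : ℕ} {v : (Fin n → ℂ) → ℂ} {M : ℝ≥0∞}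
    (hv : IntegrableOn (fun z => ((‖vand z‖ ^ 2 : ℝ) : ℂ) * v (symmMap n z)) (polydisc n))
    (h : ENNReal.ofReal ‖∫ z in polydisc n, ((‖vand z‖ ^ 2 : ℝ) : ℂ) * v (symmMap n z)‖ = M) :
    ENNReal.ofReal ‖∫ w in symmPolydisc n, v w‖ = (n.factorial : ℝ≥0∞)⁻¹ * M := by
  have hn0 : (n.factorial : ℝ≥0∞) ≠ 0 := by exact_mod_cast n.factorial_ne_zero
  rw [← h, integral_symmMap n v hv, norm_mul, ENNReal.ofReal_mul (norm_nonneg _),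
    Complex.norm_natCast, ENNReal.ofReal_natCast, ← mul_assoc,
    ENNReal.inv_mul_cancel hn0 (ENNReal.natCast_ne_top _), one_mul]

lemma setLIntegral_symmPolydisc_eq {n : ℕ} {v : (Fin n → ℂ) → ℝ≥0∞} {M : ℝ≥0∞}
    (h : ∫⁻ z in polydisc n, ENNReal.ofReal (‖vand z‖ ^ 2) * v (symmMap n z) = M) :
    ∫⁻ w in symmPolydisc n, v w = (n.factorial : ℝ≥0∞)⁻¹ * M := by
  have hn0 : (n.factorial : ℝ≥0∞) ≠ 0 := by exact_mod_cast n.factorial_ne_zero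
  rw [← h, lintegral_symmMap n v, ← mul_assoc,
    ENNReal.inv_mul_cancel hn0 (ENNReal.natCast_ne_top _), one_mul]

lemma conj_mul_norm_sq (x y v : ℂ) :
    ((‖v‖ ^ 2 : ℝ) : ℂ) * (conj x * y) = conj (v * x) * (v * y) := by
  rw [← Complex.normSq_eq_norm_sq, ← Complex.mul_conj, map_mul]
  ring

theorem not_bergmanBoundedOn_symmPolydisc {m : ℕ} (hm : 1 ≤ m) {p : ℝ}
    (hp : p = 2 * ((m : ℝ) + 1) / m) :
    ¬ BergmanBoundedOn (symmPolydisc (m + 1)) (ENNReal.ofReal p)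
      (volume.restrict (symmPolydisc (m + 1)))
      {f | MemLp f (ENNReal.ofReal p) (volume.restrict (symmPolydisc (m + 1)))} := by
  have hm0 : (0 : ℝ) < m := by exact_mod_cast hm
  have hpq := holderConjugate_exponents hm hp
  set q : ℝ := 2 * ((m : ℝ) + 1) / (m + 2) with hq
  have hmp : m * p = 2 * ((m : ℝ) + 1) := by rw [hp]; field_simp
  have hmq : ((m : ℝ) + 2) * q = 2 * ((m : ℝ) + 1) := by rw [hq]; field_simp
  -- The unweighted space is the case `W = 1` of the weighted criterion.
  have hν : volume.restrict (symmPolydisc (m + 1)) =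
      (volume.restrict (symmPolydisc (m + 1))).withDensity fun _ => ENNReal.ofReal 1 := by
    rw [withDensity_const, ENNReal.ofReal_one, one_smul]
  have hfac : ((m + 1).factorial : ℝ≥0∞) ≠ 0 := by exact_mod_cast (m + 1).factorial_ne_zero
  have hfacC : ((m + 1).factorial : ℂ) ≠ 0 := by exact_mod_cast (m + 1).factorial_ne_zero
  have key := not_bergmanBoundedOn_of_test_functions (m := m) (Ω := symmPolydisc (m + 1)) hpq
    (W := fun _ => 1) aemeasurable_const (Filter.Eventually.of_forall fun _ => one_pos)
    (X := {f | MemLp f (ENNReal.ofReal p) (volume.restrict (symmPolydisc (m + 1)))})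
    (r := ((m + 1).factorial : ℝ≥0∞)⁻¹) (ENNReal.inv_ne_zero.2 (ENNReal.natCast_ne_top _))
    (ENNReal.inv_ne_top.2 hfac) (projFactor_pos (m + 1)) ?_
  · rwa [← hν] at key
  intro a ha0 ha1
  have hD := (isOpen_polydisc (m + 1)).measurableSet
  have hE := (isCompact_mobPolydisc (m + 1) ha0 ha1).isClosed.measurableSet
  have hE' : MeasurableSet (symmMap (m + 1) '' mobPolydisc (m + 1) a) :=
    ((isCompact_mobPolydisc (m + 1) ha0 ha1).image
      (differentiable_symmMap (m + 1)).continuous).isClosed.measurableSet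
  have hsub := mobPolydisc_subset (m + 1) ha0 ha1
  -- `h` and `H` are chosen so that `vand` times their pull-backs are `testFun` and `antiKernel`
  -- (`hvh`, `hvH`).
  set h : (Fin (m + 1) → ℂ) → ℂ := fun w => conj (symmDen a w) * (symmDen a w ^ (m + 1))⁻¹ with hh
  set H : (Fin (m + 1) → ℂ) → ℂ := fun w => (symmDen a w ^ ((m + 1) + 1))⁻¹ with hH
  have hcd := (differentiable_symmDen (m + 1) a).continuous
  have hhm : Measurable h :=
    (Complex.continuous_conj.comp hcd).measurable.mul (hcd.pow (m + 1)).measurable.inv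
  have hHm : Measurable H := (hcd.pow ((m + 1) + 1)).measurable.inv
  have hhc : ContinuousOn (fun z => h (symmMap (m + 1) z)) (closedPolydisc (m + 1)) := by
    simp only [hh, symmDen_symmMap]
    refine ContinuousOn.mul (Complex.continuous_conj.comp (continuous_den (m + 1) a)).continuousOn
      (ContinuousOn.inv₀ ((continuous_den (m + 1) a).pow (m + 1)).continuousOn fun z hz =>
        pow_ne_zero (m + 1) (den_ne_zero_of_mem_closedPolydisc ha0 ha1 hz))
  have hHc : ContinuousOn (fun z => H (symmMap (m + 1) z)) (closedPolydisc (m + 1)) := by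
    simp only [hH, symmDen_symmMap]
    exact ContinuousOn.inv₀ ((continuous_den (m + 1) a).pow ((m + 1) + 1)).continuousOn fun z hz =>
        pow_ne_zero ((m + 1) + 1) (den_ne_zero_of_mem_closedPolydisc ha0 ha1 hz)
  have hHL : MemLp H 2 (volume.restrict (symmPolydisc (m + 1))) := memLp_symmPolydisc hHm hHc 2
  have hvH : ∀ z, vand z * H (symmMap (m + 1) z) = antiKernel a z := fun z => by
    simp only [hH, symmDen_symmMap, antiKernel]
  have hvh : ∀ z, vand z * h (symmMap (m + 1) z) = testFun a z := fun z => by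
    simp only [hh, symmDen_symmMap, testFun]
  have hvF : ∀ z, vand z * (symmMap (m + 1) '' mobPolydisc (m + 1) a).indicator H (symmMap (m + 1) z) =
      (mobPolydisc (m + 1) a).indicator (antiKernel a) z := by
    intro z
    by_cases hz : z ∈ mobPolydisc (m + 1) a
    · rw [indicator_of_mem hz, indicator_of_mem (symmMap_mem_image_mobPolydisc.2 hz), hvH]
    · rw [indicator_of_notMem hz, indicator_of_notMem fun h' =>
        hz (symmMap_mem_image_mobPolydisc.1 h'), mul_zero]
  clear_value h H
  have hK2 : MemLp (antiKernel a) 2 (volume.restrict (polydisc (m + 1))) :=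
    memLp_of_continuousOn_closedPolydisc (continuousOn_antiKernel ha0 ha1 (m + 1)) 2
  have hT2 : MemLp (testFun a) 2 (volume.restrict (polydisc (m + 1))) :=
    memLp_of_continuousOn_closedPolydisc (continuousOn_testFun ha0 ha1 (m + 1)) 2
  have hint : ∀ {x y : (Fin (m + 1) → ℂ) → ℂ}, MemLp x 2 (volume.restrict (polydisc (m + 1))) →
      MemLp y 2 (volume.restrict (polydisc (m + 1))) →
      IntegrableOn (fun z => conj (x z) * y z) (polydisc (m + 1)) := fun hx hy =>
    (MemLp.star hx).integrable_mul hy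
  have hvpos : ∀ᵐ z ∂(volume.restrict (polydisc (m + 1))), 0 < ‖vand z‖ := by
    refine ae_restrict_of_ae ?_
    filter_upwards [ae_injective (m + 1)] with z hz
    exact norm_pos_iff.2 ((vand_ne_zero_iff z).2 hz)
  refine ⟨h, memLp_symmPolydisc hhm hhc _, (symmMap (m + 1) '' mobPolydisc (m + 1) a).indicator H, H,
    memLp_symmPolydisc hhm hhc 2, hHL.indicator hE', hHL, ?_, ?_, ?_, ?_,
    (lintegral_testDensity_ne_top ha0 ha1 (m + 1)).2, ?_⟩
  · rw [hH]
    refine DifferentiableOn.inv ((differentiable_symmDen (m + 1) a).pow ((m + 1) + 1)).differentiableOn ?_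
    rintro _ ⟨z, hz, rfl⟩
    rw [symmDen_symmMap]
    exact pow_ne_zero _ (den_ne_zero ha0 ha1 hz)
  -- Both integrals are pulled back to the polydisc, where `vand · (u ∘ symmMap)` lies in the
  -- Bergman space and the identity for `antiKernel` applies; then `n!` is cancelled.
  · intro u hud hu
    obtain ⟨hUd, hU⟩ := memLp_vand_mul_comp_symmMap hud hu
    have h1 := integral_symmMap (m + 1)
      (fun w => conj ((symmMap (m + 1) '' mobPolydisc (m + 1) a).indicator H w) * u w) (by
        simp_rw [conj_mul_norm_sq, hvF]
        exact hint (hK2.indicator hE) hU)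
    have h2 := integral_symmMap (m + 1) (fun w => conj (H w) * u w) (by
        simp_rw [conj_mul_norm_sq, hvH]
        exact hint hK2 hU)
    simp_rw [conj_mul_norm_sq, hvF] at h1
    simp_rw [conj_mul_norm_sq, hvH] at h2
    rw [setIntegral_conj_indicator_mul hE hsub, integral_mobPolydisc_antiKernel ha0 ha1 hUd hU,
      h2, mul_left_comm] at h1
    exact (mul_left_cancel₀ hfacC h1).symm
  -- The real Jacobian supplies the weight: `|V|² |h|^p = |V h|^p |V|^(2-p)`.
  · refine setLIntegral_symmPolydisc_eq ?_
    refine lintegral_congr_ae ?_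
    filter_upwards [hvpos, ae_restrict_mem hD] with z hz hzD
    rw [← ENNReal.ofReal_mul (by positivity), testDensity, mul_one,
      ← testFun_rpow hmp hz (norm_pos_iff.2 (den_ne_zero ha0 ha1 hzD)), ← norm_testFun, ← hvh,
      norm_mul, Real.mul_rpow (norm_nonneg _) (norm_nonneg _), mul_right_comm,
      ← Real.rpow_add hz]
    norm_num
  · refine setLIntegral_symmPolydisc_eq ?_
    have hi : ∀ z, ENNReal.ofReal (‖vand z‖ ^ 2) * ENNReal.ofReal
        (‖(symmMap (m + 1) '' mobPolydisc (m + 1) a).indicator H (symmMap (m + 1) z)‖ ^ q * 1 ^ (1 - q)) =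
        ENNReal.ofReal (‖(mobPolydisc (m + 1) a).indicator (fun z => H (symmMap (m + 1) z)) z‖ ^ q *
          ‖vand z‖ ^ 2) := by
      intro z
      rw [← ENNReal.ofReal_mul (by positivity), Real.one_rpow, mul_one, mul_comm]
      congr 4
      by_cases hz : z ∈ mobPolydisc (m + 1) a
      · rw [indicator_of_mem hz, indicator_of_mem (symmMap_mem_image_mobPolydisc.2 hz)]
      · rw [indicator_of_notMem hz, indicator_of_notMem fun h' =>
          hz (symmMap_mem_image_mobPolydisc.1 h')]
    simp_rw [hi]
    rw [setLIntegral_indicator_rpow hE hsub _ _ hpq.symm.pos]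
    refine lintegral_congr_ae ?_
    filter_upwards [ae_mono (Measure.restrict_mono_set _ hsub) hvpos, ae_restrict_mem hE]
      with z hz hzE
    rw [testDensity, ← antiKernel_rpow hpq hmq hz
      (norm_pos_iff.2 (den_ne_zero ha0 ha1 (hsub hzE))), ← norm_antiKernel, ← hvH, norm_mul,
      Real.mul_rpow (norm_nonneg _) (norm_nonneg _), ← Real.rpow_mul hz.le, mul_right_comm,
      ← Real.rpow_add hz, mul_comm]
    congr 2
    rw [← Real.rpow_natCast]
    congr 1
    have := hpq.mul_eq_add
    push_cast; linarith
  · refine ofReal_norm_setIntegral_symmPolydisc ?_ ?_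
    · simp_rw [conj_mul_norm_sq, hvH, hvh]
      exact hint hK2 hT2
    · simp_rw [conj_mul_norm_sq, hvH, hvh]
      exact enorm_integral_conj_antiKernel_mul_testFun ha0 ha1 (m + 1)

end SymmetrizedPolydisc

theorem theorem2p4 (n : ℕ) (hn : 2 ≤ n) (p : ℝ) (hp : p = 2 * (n : ℝ) / ((n : ℝ) - 1)) :
    ¬ BergmanBoundedOn (polydisc n) (ENNReal.ofReal p) (weightedMeasure n p) (LpAnti n p) ∧
    ¬ BergmanBoundedOn (symmPolydisc n) (ENNReal.ofReal p) (volume.restrict (symmPolydisc n))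
        {f | MemLp f (ENNReal.ofReal p) (volume.restrict (symmPolydisc n))} := by
  obtain ⟨m, rfl⟩ : ∃ m, n = m + 1 := ⟨n - 1, by omega⟩
  have hm : 1 ≤ m := by omega
  have hp' : p = 2 * ((m : ℝ) + 1) / m := by rw [hp]; push_cast; ring
  exact ⟨not_bergmanBoundedOn_polydisc hm hp', not_bergmanBoundedOn_symmPolydisc hm hp'⟩
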